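/- Let $G$ be a real, connected, compact, semisimple Lie group of dimension $3$, with Lie algebra $\mathfrak g$. Call the orbit of a flow $\psi_t$ through $g\in G$ periodic if it is not reduced to the point $g$ and there is $T>0$ with $\psi_{t+T}(g)=\psi_t(g)$ for all $t\in\mathbb R$. (i) For every $X\in\mathfrak g$, the flow of the right invariant vector field on $G$ with value $X$ at the identity (that is, of the differential equation $\dot g=X(g)$) is defined for all times and is given by $g\mapsto \exp(tX)\,g$. If $X\neq 0$, then every orbit of this flow is periodic. (If $X=0$, every point is fixed.) (ii) Let $\mathcal X$ be a linear vector field on $G$, that is, a smooth vector field whose flow $(\varphi_t)_{t\in\mathbb R}$ consists of automorphisms of the Lie group $G$. Then every orbit of $\varphi_t$ is either a fixed point or periodic. -/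

import Mathlib

open scoped Manifold ContDiff

noncomputable section

section LieGroupFlows

variable {E : Type*} [NormedAddCommGroup E] [NormedSpace ℝ E]
  {H : Type*} [TopologicalSpace H] (I : ModelWithCorners ℝ E H)
  {G : Type*} [TopologicalSpace G] [ChartedSpace H G] [Group G]

/-- A smooth real Lie group has the smoothness that Mathlib asks for in order to equip the tangent
space at the identity, `GroupLieAlgebra I G`, with its Lie algebra structure. -/
instance instLieGroupMinSmoothnessThree [LieGroup I ∞ G] : LieGroup I (minSmoothness ℝ 3) G :=
  LieGroup.of_le (m := minSmoothness ℝ 3) (n := ∞)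
    (by
      rw [minSmoothness_of_isRCLikeNormedField]
      exact WithTop.coe_le_coe.2 (le_top : (3 : ℕ∞) ≤ ⊤))

/-- The right invariant vector field with value `v` at the identity: its value at `g` is the image
of `v` under the differential at `1` of the right translation `x ↦ x * g`. -/
def rightInvariantVectorField (v : GroupLieAlgebra I G) (g : G) : TangentSpace I g :=
  (mfderiv I I (fun x : G => x * g) 1 v : TangentSpace I ((1 : G) * g))

/-- `φ` is the global flow of the vector field `V`: for each `g`, the curve `t ↦ φ t g` is the
integral curve of `V`, defined for all times, that starts at `g`. -/
structure IsFlowOf (V : (g : G) → TangentSpace I g) (φ : ℝ → G → G) : Prop where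
  map_zero : ∀ g, φ 0 g = g
  isMIntegralCurve : ∀ g, IsMIntegralCurve (I := I) (fun t => φ t g) V

/-- `f` is an automorphism of the Lie group `G`: a group automorphism that is smooth together with
its inverse. -/
def IsLieGroupAutomorphism (f : G → G) : Prop :=
  ∃ ψ : G ≃* G, ContMDiff I I ∞ ψ ∧ ContMDiff I I ∞ ψ.symm ∧ ∀ g, ψ g = f g

/-- A smooth vector field on `G` is linear if its flow consists of automorphisms of the Lie group
`G`. -/
structure IsLinearVectorField [LieGroup I ∞ G] (V : (g : G) → TangentSpace I g) : Prop where
  contMDiff : ContMDiff I I.tangent ∞ (fun g => (⟨g, V g⟩ : TangentBundle I G))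
  exists_flow : ∃ φ : ℝ → G → G, IsFlowOf I V φ ∧ ∀ t, IsLieGroupAutomorphism I (φ t)

/-- The exponential map of the Lie group `G`: the value at time `1` of the integral curve through
the identity of the right invariant vector field given by `v` (this curve is the one-parameter
subgroup with velocity `v` at `0`). -/
def lieGroupExp (v : GroupLieAlgebra I G) : G :=
  Classical.epsilon (fun γ : ℝ → G =>
    γ 0 = 1 ∧ IsMIntegralCurve (I := I) γ (rightInvariantVectorField I v)) 1

end LieGroupFlows

/-- The orbit described by the trajectory `γ` is periodic: it is not reduced to a point, and `γ` has
a period `T > 0`. -/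
def IsPeriodicOrbit {M : Type*} (γ : ℝ → M) : Prop :=
  (∃ t, γ t ≠ γ 0) ∧ ∃ T : ℝ, 0 < T ∧ ∀ t, γ (t + T) = γ t

end

/-!
Averaging gives an inner product `B` on the Lie algebra `𝔤` invariant under the adjoint
representation, so each `Ad (exp (t y))` is an isometry of a three-dimensional space, hence a
rotation about `y`. Its angle is not constantly zero if `y ≠ 0`, because the center of `𝔤` is
trivial, so by continuity of the trace it is `π` for some `t`: every half-turn lies in the image of
`Ad`.

For (i), `Ad (exp (T x)) = 1` for some `T > 0`, so `exp (T x)` is central. An element `g` whose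
adjoint action is a half-turn about an axis orthogonal to `x` conjugates it to `exp (-T x)`, whence
`exp (2 T x) = 1`.

For (ii), the one-parameter subgroups of `x` and `D x`, where `D` is the differential of an
automorphism, have the same group of periods. A half-turn carries a multiple of `x` to `D x`, and
the periods of `x`, a proper closed subgroup of `ℝ` other than `0`, detect the scaling factor, so
`D` is an isometry of `B`. If now `D t` is the differential of the flow `φ t` and `Ad g` is the
half-turn about `y`, then `Ad (φ t g)` is the half-turn about `D t y`, so the latter is continuous
in `t`. This gives the continuity of the trace of `D t ^ 2 = D (2 t)`, hence that of `D t`, and a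
one-parameter group of rotations with continuous trace is periodic.
-/

open Module Matrix Filter Set
open scoped Topology

section DoubleAngle

variable {f : ℝ → ℝ}

theorem two_pow_mul_one_sub_le_of_double_angle (hdouble : ∀ t, f (2 * t) = 2 * f t ^ 2 - 1)
    (hnonneg : ∀ t, 0 ≤ f t) (hle : ∀ t, f t ≤ 1) (t : ℝ) (n : ℕ) :
    2 ^ n * (1 - f t) ≤ 1 - f (2 ^ n * t) := by
  induction n with
  | zero => simp
  | succ n ih =>
    calc 2 ^ (n + 1) * (1 - f t) = 2 * (2 ^ n * (1 - f t)) := by ring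
      _ ≤ 2 * (1 - f (2 ^ n * t)) := by gcongr
      _ ≤ 2 * (1 - f (2 ^ n * t)) * (1 + f (2 ^ n * t)) := by
        nlinarith [hnonneg (2 ^ n * t), hle (2 ^ n * t)]
      _ = 1 - f (2 * (2 ^ n * t)) := by rw [hdouble]; ring
      _ = 1 - f (2 ^ (n + 1) * t) := by ring_nf

theorem eq_one_of_double_angle_of_nonneg (hdouble : ∀ t, f (2 * t) = 2 * f t ^ 2 - 1)
    (hnonneg : ∀ t, 0 ≤ f t) (hle : ∀ t, f t ≤ 1) (t : ℝ) : f t = 1 := by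
  by_contra hne
  have hlt : 0 < 1 - f t := sub_pos.2 ((hle t).lt_of_ne hne)
  obtain ⟨n, hn⟩ := pow_unbounded_of_one_lt (1 / (1 - f t)) (one_lt_two : (1 : ℝ) < 2)
  rw [div_lt_iff₀ hlt] at hn
  linarith [two_pow_mul_one_sub_le_of_double_angle hdouble hnonneg hle t n, hnonneg (2 ^ n * t)]

theorem eq_one_or_exists_eq_neg_one_of_double_angle (hcont : Continuous f) (hzero : f 0 = 1)
    (hdouble : ∀ t, f (2 * t) = 2 * f t ^ 2 - 1) (hle : ∀ t, f t ≤ 1) :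
    (∀ t, f t = 1) ∨ ∃ t, f t = -1 := by
  by_cases hnonneg : ∀ t, 0 ≤ f t
  · exact .inl (eq_one_of_double_angle_of_nonneg hdouble hnonneg hle)
  · push Not at hnonneg
    obtain ⟨t, ht⟩ := hnonneg
    obtain ⟨s, hs⟩ : ∃ s, f s = 0 :=
      mem_range_of_exists_le_of_exists_ge hcont ⟨t, ht.le⟩ ⟨0, hzero ▸ zero_le_one⟩
    exact .inr ⟨2 * s, by rw [hdouble, hs]; norm_num⟩

end DoubleAngle

section OrthogonalMatrix

theorem trace_mul_self_of_transpose_mul_self {K : Type*} [CommRing K]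
    {R : Matrix (Fin 3) (Fin 3) K} (hR : Rᵀ * R = 1) (hdet : R.det = 1) :
    (R * R).trace = R.trace ^ 2 - 2 * R.trace := by
  have hadj : R.adjugate = Rᵀ :=
    calc R.adjugate = Rᵀ * R * R.adjugate := by rw [hR, one_mul]
      _ = Rᵀ := by rw [mul_assoc, mul_adjugate, hdet, one_smul, mul_one]
  have key : (R * R).trace = R.trace ^ 2 - 2 * R.adjugate.trace := by
    simp only [trace_fin_three, adjugate_fin_three, mul_apply, Fin.sum_univ_three, of_apply,
      cons_val]
    ring
  rw [key, hadj, trace_transpose]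

variable {n : Type*} [Fintype n] [DecidableEq n] {R : Matrix n n ℝ}

theorem trace_transpose_sub_one_mul_sub_one (hR : Rᵀ * R = 1) :
    ((R - 1)ᵀ * (R - 1)).trace = 2 * (Fintype.card n - R.trace) := by
  have : (R - 1)ᵀ * (R - 1) = Rᵀ * R - Rᵀ - R + 1 := by
    rw [transpose_sub, transpose_one]
    noncomm_ring
  rw [this, hR, trace_add, trace_sub, trace_sub, trace_transpose, trace_one]
  ring

theorem trace_le_card_of_transpose_mul_self (hR : Rᵀ * R = 1) : R.trace ≤ Fintype.card n := by
  have h : 0 ≤ ((R - 1)ᵀ * (R - 1)).trace :=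
    Finset.sum_nonneg fun i _ => Finset.sum_nonneg fun j _ => mul_self_nonneg _
  linarith [trace_transpose_sub_one_mul_sub_one hR]

theorem eq_one_of_trace_eq_card (hR : Rᵀ * R = 1) (htr : R.trace = Fintype.card n) : R = 1 := by
  refine sub_eq_zero.1 (trace_conjTranspose_mul_self_eq_zero_iff.1 ?_)
  rw [conjTranspose_eq_transpose_of_trivial, trace_transpose_sub_one_mul_sub_one hR, htr]
  ring

end OrthogonalMatrix

section InnerProduct

variable {V : Type*} [AddCommGroup V] [Module ℝ V]

/-- `B` is an inner product on `V`. This is a predicate on bilinear forms, rather than an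
`InnerProductSpace` structure, because it is applied to tangent spaces, which already carry a
topology and for which a second norm would be in the way. -/
structure IsInnerProduct (B : LinearMap.BilinForm ℝ V) : Prop where
  symm : ∀ v w, B v w = B w v
  pos : ∀ v, v ≠ 0 → 0 < B v v

/-- The half-turn about the line spanned by `y`: it fixes `y` and is `-1` on the orthogonal
complement of `y` with respect to `B`. -/
noncomputable def halfTurn (B : LinearMap.BilinForm ℝ V) (y : V) : Module.End ℝ V :=
  (2 / B y y) • (B y).smulRight y - 1

theorem halfTurn_apply (B : LinearMap.BilinForm ℝ V) (y v : V) :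
    halfTurn B y v = (2 * B y v / B y y) • y - v := by
  simp only [halfTurn, LinearMap.sub_apply, LinearMap.smul_apply, LinearMap.smulRight_apply,
    End.one_apply, smul_smul, div_mul_eq_mul_div]

theorem halfTurn_apply_of_eq_zero {B : LinearMap.BilinForm ℝ V} {y v : V} (h : B y v = 0) :
    halfTurn B y v = -v := by
  rw [halfTurn_apply, h, mul_zero, zero_div, zero_smul, zero_sub]

theorem halfTurn_map {B : LinearMap.BilinForm ℝ V} {L : Module.End ℝ V}
    (hL : ∀ v w, B (L v) (L w) = B v w) (y v : V) :
    halfTurn B (L y) (L v) = L (halfTurn B y v) := by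
  simp only [halfTurn_apply, hL, map_sub, map_smul]

namespace IsInnerProduct

variable {B : LinearMap.BilinForm ℝ V}

theorem nonneg (hB : IsInnerProduct B) (v : V) : 0 ≤ B v v := by
  rcases eq_or_ne v 0 with rfl | hv
  · simp
  · exact (hB.pos v hv).le

theorem exists_basis [FiniteDimensional ℝ V] (hB : IsInnerProduct B) :
    ∃ b : Basis (Fin (finrank ℝ V)) ℝ V, LinearMap.BilinForm.toMatrix b B = 1 := by
  let c : InnerProductSpace.Core ℝ V :=
    { inner := fun v w => B v w
      conj_inner_symm := fun v w => hB.symm w v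
      re_inner_nonneg := hB.nonneg
      add_left := fun u v w => by simp
      smul_left := fun u v r => by simp
      definite := fun v hv => by
        by_contra hne
        exact (hB.pos v hne).ne' hv }
  let _ : NormedAddCommGroup V := c.toNormedAddCommGroup
  let _ : InnerProductSpace ℝ V := InnerProductSpace.ofCore c.toCore
  let b := stdOrthonormalBasis ℝ V
  refine ⟨b.toBasis, Matrix.ext fun i j => ?_⟩
  rw [LinearMap.BilinForm.toMatrix_apply, b.coe_toBasis, one_apply,
    ← orthonormal_iff_ite.1 b.orthonormal i j]
  rfl

theorem exists_ne_zero_apply_eq_zero (hB : IsInnerProduct B) (hV : 1 < finrank ℝ V) (x : V) :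
    ∃ y, y ≠ 0 ∧ B y x = 0 := by
  have : FiniteDimensional ℝ V := FiniteDimensional.of_finrank_pos (by lia)
  have hrange : finrank ℝ (B x).range ≤ 1 := by
    simpa using (B x).range.finrank_le
  have hker : 0 < finrank ℝ (B x).ker := by
    have := (B x).finrank_range_add_finrank_ker
    lia
  obtain ⟨⟨y, hy⟩, hy0⟩ := finrank_pos_iff_exists_ne_zero.1 hker
  exact ⟨y, fun h => hy0 (Subtype.ext h), by rw [hB.symm]; exact hy⟩

section Isometry

variable {L : Module.End ℝ V}

theorem apply_apply_of_self (hB : IsInnerProduct B) (hL : ∀ v, B (L v) (L v) = B v v) (v w : V) :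
    B (L v) (L w) = B v w := by
  have h := hL (v + w)
  simp only [map_add, LinearMap.add_apply, hL, hB.symm w v, hB.symm (L w) (L v)] at h
  linarith

theorem transpose_toMatrix_mul_toMatrix {ι : Type*} [Fintype ι] [DecidableEq ι]
    {b : Basis ι ℝ V} (hb : LinearMap.BilinForm.toMatrix b B = 1)
    (hL : ∀ v w, B (L v) (L w) = B v w) :
    (LinearMap.toMatrix b b L)ᵀ * LinearMap.toMatrix b b L = 1 := by
  have h : B.comp L L = B := LinearMap.ext₂ hL
  rw [← hb, ← congrArg (LinearMap.BilinForm.toMatrix b) h,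
    LinearMap.BilinForm.toMatrix_comp b b, hb, mul_one]

variable [FiniteDimensional ℝ V]

theorem trace_le_finrank (hB : IsInnerProduct B) (hL : ∀ v w, B (L v) (L w) = B v w) :
    LinearMap.trace ℝ V L ≤ finrank ℝ V := by
  obtain ⟨b, hb⟩ := hB.exists_basis
  simpa [LinearMap.trace_eq_matrix_trace ℝ b] using
    trace_le_card_of_transpose_mul_self (transpose_toMatrix_mul_toMatrix hb hL)

theorem eq_one_of_trace_eq_finrank (hB : IsInnerProduct B) (hL : ∀ v w, B (L v) (L w) = B v w)
    (htr : LinearMap.trace ℝ V L = finrank ℝ V) : L = 1 := by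
  obtain ⟨b, hb⟩ := hB.exists_basis
  rw [LinearMap.trace_eq_matrix_trace ℝ b] at htr
  refine (LinearMap.toMatrix b b).injective ?_
  rw [LinearMap.toMatrix_one]
  exact eq_one_of_trace_eq_card (transpose_toMatrix_mul_toMatrix hb hL) (by simpa using htr)

theorem det_mul_self (hB : IsInnerProduct B) (hL : ∀ v w, B (L v) (L w) = B v w) :
    LinearMap.det (L * L) = 1 := by
  obtain ⟨b, hb⟩ := hB.exists_basis
  have h := congrArg Matrix.det (transpose_toMatrix_mul_toMatrix hb hL)
  rw [det_mul, det_transpose, det_one, LinearMap.det_toMatrix] at h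
  rwa [map_mul]

theorem trace_mul_self (hB : IsInnerProduct B) (hV : finrank ℝ V = 3)
    (hL : ∀ v w, B (L v) (L w) = B v w) (hdet : LinearMap.det L = 1) :
    LinearMap.trace ℝ V (L * L) = LinearMap.trace ℝ V L ^ 2 - 2 * LinearMap.trace ℝ V L := by
  obtain ⟨b, hb⟩ : ∃ b : Basis (Fin 3) ℝ V, LinearMap.BilinForm.toMatrix b B = 1 :=
    hV ▸ hB.exists_basis
  rw [LinearMap.trace_eq_matrix_trace ℝ b, LinearMap.trace_eq_matrix_trace ℝ b,
    LinearMap.toMatrix_mul]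
  exact trace_mul_self_of_transpose_mul_self (transpose_toMatrix_mul_toMatrix hb hL)
    (by rwa [LinearMap.det_toMatrix])

end Isometry

section HalfTurn

variable {y : V}

theorem halfTurn_halfTurn (hB : IsInnerProduct B) (hy : y ≠ 0) (v : V) :
    halfTurn B y (halfTurn B y v) = v := by
  have h : B y (halfTurn B y v) = B y v := by
    rw [halfTurn_apply, map_sub, map_smul, smul_eq_mul, div_mul_cancel₀ _ (hB.pos y hy).ne']
    ring
  rw [halfTurn_apply, h, halfTurn_apply, sub_sub_cancel]

theorem apply_halfTurn_halfTurn (hB : IsInnerProduct B) (hy : y ≠ 0) (v w : V) :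
    B (halfTurn B y v) (halfTurn B y w) = B v w := by
  have hyy := (hB.pos y hy).ne'
  simp only [halfTurn_apply, map_sub, map_smul, LinearMap.sub_apply, LinearMap.smul_apply,
    smul_eq_mul, hB.symm v y]
  field_simp
  ring

theorem halfTurn_add_apply (hB : IsInnerProduct B) {x : V} (hxy : B x x = B y y)
    (hne : x + y ≠ 0) : halfTurn B (x + y) x = y := by
  have h : 2 * B (x + y) x = B (x + y) (x + y) := by
    simp only [map_add, LinearMap.add_apply, hxy, hB.symm x y]
    ring
  rw [halfTurn_apply, h, div_self (hB.pos _ hne).ne', one_smul, add_sub_cancel_left]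

theorem exists_halfTurn_apply_eq (hB : IsInnerProduct B) (hV : 1 < finrank ℝ V) {x : V}
    (hxy : B x x = B y y) : ∃ z, z ≠ 0 ∧ halfTurn B z x = y := by
  rcases eq_or_ne (x + y) 0 with hadd | hadd
  · obtain ⟨z, hz, hzx⟩ := hB.exists_ne_zero_apply_eq_zero hV x
    exact ⟨z, hz, by rw [halfTurn_apply_of_eq_zero hzx, neg_eq_of_add_eq_zero_right hadd]⟩
  · exact ⟨x + y, hadd, hB.halfTurn_add_apply hxy hadd⟩

theorem eq_halfTurn (hB : IsInnerProduct B) (hV : finrank ℝ V = 3) {L : Module.End ℝ V}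
    (hL : ∀ v w, B (L v) (L w) = B v w) (htr : LinearMap.trace ℝ V L = -1) (hy : y ≠ 0)
    (hLy : L y = y) : L = halfTurn B y := by
  have : FiniteDimensional ℝ V := FiniteDimensional.of_finrank_eq_succ hV
  have hmul : L * halfTurn B y = (2 / B y y) • (B y).smulRight y - L := by
    ext v
    simp [halfTurn, hLy]
  have htrace : LinearMap.trace ℝ V (L * halfTurn B y) = finrank ℝ V := by
    rw [hmul, map_sub, map_smul, LinearMap.trace_smulRight, htr, hV, smul_eq_mul,
      div_mul_cancel₀ _ (hB.pos y hy).ne']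
    norm_num
  have hone : L * halfTurn B y = 1 := hB.eq_one_of_trace_eq_finrank
    (fun v w => by rw [End.mul_apply, End.mul_apply, hL, hB.apply_halfTurn_halfTurn hy]) htrace
  ext v
  simpa [hB.halfTurn_halfTurn hy] using LinearMap.congr_fun hone (halfTurn B y v)

end HalfTurn

section OneParameterGroup

variable {R : ℝ → Module.End ℝ V}

theorem forall_eq_one_or_exists_trace_eq_neg_one (hB : IsInnerProduct B) (hV : finrank ℝ V = 3)
    (hzero : R 0 = 1) (hadd : ∀ s t, R (s + t) = R s * R t)
    (hisom : ∀ t v w, B (R t v) (R t w) = B v w)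
    (hcont : Continuous fun t => LinearMap.trace ℝ V (R t)) :
    (∀ t, R t = 1) ∨ ∃ t, LinearMap.trace ℝ V (R t) = -1 := by
  have : FiniteDimensional ℝ V := FiniteDimensional.of_finrank_eq_succ hV
  have hdet (t : ℝ) : LinearMap.det (R t) = 1 := by
    rw [← add_halves t, hadd, hB.det_mul_self (hisom _)]
  have hdouble (t : ℝ) : LinearMap.trace ℝ V (R (2 * t)) =
      LinearMap.trace ℝ V (R t) ^ 2 - 2 * LinearMap.trace ℝ V (R t) := by
    rw [two_mul, hadd, hB.trace_mul_self hV (hisom t) (hdet t)]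
  have hle (t : ℝ) := hB.trace_le_finrank (hisom t)
  rw [hV] at hle
  push_cast at hle
  -- The trace of a rotation of angle `θ` is `1 + 2 cos θ`.
  rcases eq_one_or_exists_eq_neg_one_of_double_angle
      (f := fun t => (LinearMap.trace ℝ V (R t) - 1) / 2) (by fun_prop)
      (by simp only [hzero, LinearMap.trace_one, hV]; norm_num)
      (fun t => by rw [hdouble]; ring) (fun t => by linarith [hle t]) with htriv | ⟨t, ht⟩
  · refine .inl fun t => hB.eq_one_of_trace_eq_finrank (hisom t) ?_
    rw [hV]
    push_cast
    linarith [htriv t]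
  · exact .inr ⟨t, by linarith⟩

theorem exists_period (hB : IsInnerProduct B) (hV : finrank ℝ V = 3)
    (hzero : R 0 = 1) (hadd : ∀ s t, R (s + t) = R s * R t)
    (hisom : ∀ t v w, B (R t v) (R t w) = B v w)
    (hcont : Continuous fun t => LinearMap.trace ℝ V (R t)) : ∃ T > 0, R T = 1 := by
  have : FiniteDimensional ℝ V := FiniteDimensional.of_finrank_eq_succ hV
  rcases hB.forall_eq_one_or_exists_trace_eq_neg_one hV hzero hadd hisom hcont with htriv | ⟨t, ht⟩
  · exact ⟨1, one_pos, htriv 1⟩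
  have hdet : LinearMap.det (R t) = 1 := by
    rw [← add_halves t, hadd, hB.det_mul_self (hisom _)]
  have htwo : R (t + t) = 1 := by
    refine hB.eq_one_of_trace_eq_finrank (hisom _) ?_
    rw [hadd, hB.trace_mul_self hV (hisom t) hdet, ht, hV]
    norm_num
  have ht0 : t ≠ 0 := by
    rintro rfl
    rw [hzero, LinearMap.trace_one, hV] at ht
    norm_num at ht
  rcases lt_or_gt_of_ne ht0 with hneg | hpos
  · refine ⟨-(t + t), by linarith, ?_⟩
    rw [← mul_one (R (-(t + t))), ← htwo, ← hadd, neg_add_cancel, hzero, htwo]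
  · exact ⟨t + t, by linarith, htwo⟩

end OneParameterGroup

section Continuity

variable {ι : Type*} [Fintype ι] [DecidableEq ι] {b : Basis ι ℝ V}

theorem basis_repr_eq (hb : LinearMap.BilinForm.toMatrix b B = 1) (v : V) (i : ι) :
    b.repr v i = B v (b i) := by
  have hbij (j : ι) : B (b j) (b i) = (1 : Matrix ι ι ℝ) j i := by
    rw [← hb, LinearMap.BilinForm.toMatrix_apply]
  conv_rhs => rw [← b.sum_repr v]
  simp only [map_sum, map_smul, LinearMap.sum_apply, LinearMap.smul_apply, hbij, one_apply,
    smul_eq_mul, mul_ite, mul_one, mul_zero, Finset.sum_ite_eq', Finset.mem_univ, if_true]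

theorem sum_apply_mul_apply (hB : IsInnerProduct B) (hb : LinearMap.BilinForm.toMatrix b B = 1)
    (v w : V) : ∑ i, B v (b i) * B w (b i) = B v w := by
  conv_rhs => rw [← b.sum_repr v]
  simp only [map_sum, map_smul, LinearMap.sum_apply, LinearMap.smul_apply, smul_eq_mul,
    basis_repr_eq hb, hB.symm w]

theorem trace_mul_eq_sum (hb : LinearMap.BilinForm.toMatrix b B = 1) (L M : Module.End ℝ V) :
    LinearMap.trace ℝ V (L * M) = ∑ i, ∑ j, B (L (b j)) (b i) * B (M (b i)) (b j) := by
  rw [LinearMap.trace_eq_matrix_trace ℝ b, LinearMap.toMatrix_mul]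
  simp only [trace, diag, mul_apply, LinearMap.toMatrix_apply, basis_repr_eq hb]

variable {X : Type*} [TopologicalSpace X] {L : X → Module.End ℝ V}

theorem continuous_apply_mul_apply_self (hB : IsInnerProduct B)
    (hL : ∀ t v w, B (L t v) (L t w) = B v w)
    (hturn : ∀ y, y ≠ 0 → ∀ v w, Continuous fun t => B w (halfTurn B (L t y) v)) (y v w : V) :
    Continuous fun t => B (L t y) v * B (L t y) w := by
  rcases eq_or_ne y 0 with rfl | hy
  · simpa using continuous_const
  have heq (t : X) :
      B (L t y) v * B (L t y) w = (B w (halfTurn B (L t y) v) + B w v) * (B y y / 2) := by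
    have hyy := (hB.pos y hy).ne'
    rw [halfTurn_apply, hL, map_sub, map_smul, smul_eq_mul, hB.symm w (L t y)]
    field_simp
    ring
  exact (((hturn y hy v w).add continuous_const).mul continuous_const).congr fun t => (heq t).symm

theorem continuous_apply_mul_apply [FiniteDimensional ℝ V] (hB : IsInnerProduct B)
    (hL : ∀ t v w, B (L t v) (L t w) = B v w)
    (hself : ∀ y v w, Continuous fun t => B (L t y) v * B (L t y) w) (x y v w : V) :
    Continuous fun t => B (L t x) v * B (L t y) w := by
  have of_apply_ne_zero (y : V) (hxy : B x y ≠ 0) :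
      Continuous fun t => B (L t x) v * B (L t y) w := by
    obtain ⟨b, hb⟩ := hB.exists_basis
    have heq (t : X) : B (L t x) v * B (L t y) w =
        (∑ i, B (L t x) v * B (L t x) (b i) * (B (L t y) (b i) * B (L t y) w)) / B x y := by
      rw [eq_div_iff hxy, ← hL t x y, ← hB.sum_apply_mul_apply hb (L t x) (L t y), Finset.mul_sum]
      exact Finset.sum_congr rfl fun i _ => by ring
    simp only [heq]
    exact (continuous_finsetSum _ fun i _ =>
      (hself x v (b i)).mul (hself y (b i) w)).div_const (B x y)
  by_cases hxy : B x y = 0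
  · rcases eq_or_ne x 0 with rfl | hx
    · simpa using continuous_const
    have hadd := of_apply_ne_zero (x + y) (by rw [map_add, hxy, add_zero]; exact (hB.pos x hx).ne')
    refine (hadd.sub (hself x v w)).congr fun t => ?_
    simp only [Pi.sub_apply, map_add, LinearMap.add_apply]
    ring
  · exact of_apply_ne_zero y hxy

theorem continuous_trace_mul_self [FiniteDimensional ℝ V] (hB : IsInnerProduct B)
    (hL : ∀ t v w, B (L t v) (L t w) = B v w)
    (hturn : ∀ y, y ≠ 0 → ∀ v w, Continuous fun t => B w (halfTurn B (L t y) v)) :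
    Continuous fun t => LinearMap.trace ℝ V (L t * L t) := by
  obtain ⟨b, hb⟩ := hB.exists_basis
  simp only [trace_mul_eq_sum hb]
  exact continuous_finsetSum _ fun i _ => continuous_finsetSum _ fun j _ =>
    hB.continuous_apply_mul_apply hL (hB.continuous_apply_mul_apply_self hL hturn) _ _ _ _

theorem exists_period_of_continuous_halfTurn (hB : IsInnerProduct B) (hV : finrank ℝ V = 3)
    {R : ℝ → Module.End ℝ V} (hzero : R 0 = 1) (hadd : ∀ s t, R (s + t) = R s * R t)
    (hisom : ∀ t v w, B (R t v) (R t w) = B v w)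
    (hturn : ∀ y, y ≠ 0 → ∀ v w, Continuous fun t => B w (halfTurn B (R t y) v)) :
    ∃ T > 0, R T = 1 := by
  have : FiniteDimensional ℝ V := FiniteDimensional.of_finrank_eq_succ hV
  refine hB.exists_period hV hzero hadd hisom
    (((hB.continuous_trace_mul_self hisom hturn).comp (continuous_id.div_const 2)).congr
      fun t => ?_)
  simp only [Function.comp_apply, id, ← hadd, add_halves]

end Continuity

end IsInnerProduct

end InnerProduct

section Averaging

open MeasureTheory

variable {G : Type*} [Group G] [TopologicalSpace G] [IsTopologicalGroup G]
  {V : Type*} [AddCommGroup V] [Module ℝ V] [TopologicalSpace V]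
  {F : Type*} [AddCommGroup F] [Module ℝ F] [TopologicalSpace F] [IsTopologicalAddGroup F]
  [ContinuousSMul ℝ F]

/-- The linear map sending a vector `v` to the function `g ↦ A (ρ g⁻¹ v)` on the group. It
intertwines `ρ` with left translation of functions, so an invariant inner product on functions
pulls back to a `ρ`-invariant one. -/
def coefficientMap (A : V →L[ℝ] F) (ρ : G →* Module.End ℝ V) (hρ : ∀ v, Continuous fun g => ρ g v) :
    V →ₗ[ℝ] C(G, F) where
  toFun v := ⟨fun g => A (ρ g⁻¹ v), A.continuous.comp ((hρ v).comp continuous_inv)⟩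
  map_add' v w := by ext g; simp
  map_smul' r v := by ext g; simp

theorem coefficientMap_apply (A : V →L[ℝ] F) (ρ : G →* Module.End ℝ V)
    (hρ : ∀ v, Continuous fun g => ρ g v) (v : V) (g : G) :
    coefficientMap A ρ hρ v g = A (ρ g⁻¹ v) :=
  rfl

theorem coefficientMap_map (A : V →L[ℝ] F) (ρ : G →* Module.End ℝ V)
    (hρ : ∀ v, Continuous fun g => ρ g v) (h : G) (v : V) (g : G) :
    coefficientMap A ρ hρ (ρ h v) g = coefficientMap A ρ hρ v (h⁻¹ * g) := by
  simp [coefficientMap_apply]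

theorem exists_isInnerProduct_invariant [T2Space G] [CompactSpace G] [IsTopologicalAddGroup V]
    [ContinuousSMul ℝ V] [T2Space V] [FiniteDimensional ℝ V] (ρ : G →* Module.End ℝ V)
    (hρ : ∀ v, Continuous fun g => ρ g v) :
    ∃ B : LinearMap.BilinForm ℝ V, IsInnerProduct B ∧ ∀ g v w, B (ρ g v) (ρ g w) = B v w := by
  borelize G
  let μ : Measure G := Measure.haar
  let e : V ≃L[ℝ] EuclideanSpace ℝ (Fin (finrank ℝ V)) :=
    .ofFinrankEq finrank_euclideanSpace_fin.symm
  let c := coefficientMap (e : V →L[ℝ] EuclideanSpace ℝ (Fin (finrank ℝ V))) ρ hρ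
  let T := (ContinuousMap.toLp 2 μ ℝ).toLinearMap ∘ₗ c
  have hT : Function.Injective T := (ContinuousMap.toLp_injective (𝕜 := ℝ) μ).comp fun v w h => by
    simpa [c, coefficientMap_apply] using DFunLike.congr_fun h 1
  have hinner (v w : V) : inner ℝ (T v) (T w) = ∫ g, inner ℝ (c v g) (c w g) ∂μ := by
    rw [L2.inner_def]
    refine integral_congr_ae ?_
    filter_upwards [ContinuousMap.coeFn_toLp (𝕜 := ℝ) (p := 2) μ (c v),
      ContinuousMap.coeFn_toLp (𝕜 := ℝ) (p := 2) μ (c w)] with g hv hw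
    exact congrArg₂ _ hv hw
  refine ⟨(innerₗ _).compl₁₂ T T, ⟨fun v w => real_inner_comm (T w) (T v), fun v hv => ?_⟩,
    fun g v w => ?_⟩
  · exact real_inner_self_pos.2 ((map_ne_zero_iff T hT).2 hv)
  · simp only [LinearMap.compl₁₂_apply, innerₗ_apply_apply, hinner, c, coefficientMap_map]
    exact integral_mul_left_eq_self (fun h => inner ℝ (c v h) (c w h)) g⁻¹

end Averaging

section AddSubgroup

theorem closed_addSubgroup_eq_top_of_contraction {P : AddSubgroup ℝ} (hP : IsClosed (P : Set ℝ))
    {T c : ℝ} (hT : 0 < T) (hTP : T ∈ P) (hc : 0 < c) (hc1 : c < 1) (hcP : ∀ s ∈ P, c * s ∈ P) :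
    P = ⊤ := by
  have hpow (n : ℕ) : c ^ n * T ∈ P := by
    induction n with
    | zero => simpa using hTP
    | succ n ih =>
      rw [pow_succ', mul_assoc]
      exact hcP _ ih
  have hdense : Dense (P : Set ℝ) := P.dense_of_not_isolated_zero fun ε hε => by
    obtain ⟨n, hn⟩ := exists_pow_lt_of_lt_one (div_pos hε hT) hc1
    exact ⟨c ^ n * T, hpow n, by positivity, (lt_div_iff₀ hT).1 hn⟩
  exact SetLike.coe_injective (by rw [← hP.closure_eq, hdense.closure_eq, AddSubgroup.coe_top])

theorem eq_one_of_scaling_closed_addSubgroup {P : AddSubgroup ℝ} (hP : IsClosed (P : Set ℝ))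
    (htop : P ≠ ⊤) {T c : ℝ} (hT : 0 < T) (hTP : T ∈ P) (hc : 0 < c)
    (hcP : ∀ s, c * s ∈ P ↔ s ∈ P) : c = 1 := by
  rcases lt_trichotomy c 1 with hlt | rfl | hgt
  · exact absurd (closed_addSubgroup_eq_top_of_contraction hP hT hTP hc hlt
      fun s => (hcP s).2) htop
  · rfl
  · refine absurd (closed_addSubgroup_eq_top_of_contraction hP hT hTP (inv_pos.2 hc)
      (inv_lt_one_of_one_lt₀ hgt) fun s hs => (hcP _).1 ?_) htop
    rwa [mul_inv_cancel_left₀ hc.ne']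

end AddSubgroup

section LieBracket

open VectorField

variable {E : Type*} [NormedAddCommGroup E] [NormedSpace ℝ E]

section PartialDerivatives

variable {E' : Type*} [NormedAddCommGroup E'] [NormedSpace ℝ E']
  {F : Type*} [NormedAddCommGroup F] [NormedSpace ℝ F] {m : E × E' → F} {x : E} {y : E'}

theorem fderiv_comp_prodMk_left (hm : DifferentiableAt ℝ m (x, y)) (v : E) :
    fderiv ℝ (fun x' => m (x', y)) x v = fderiv ℝ m (x, y) (v, 0) := by
  have h := HasFDerivAt.comp (f := fun x' => (x', y)) x hm.hasFDerivAt (hasFDerivAt_prodMk_left x y)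
  exact congrArg (· v) h.fderiv

theorem fderiv_comp_prodMk_right (hm : DifferentiableAt ℝ m (x, y)) (w : E') :
    fderiv ℝ (fun y' => m (x, y')) y w = fderiv ℝ m (x, y) (0, w) := by
  have h := HasFDerivAt.comp (f := fun y' => (x, y')) y hm.hasFDerivAt
    (hasFDerivAt_prodMk_right x y)
  exact congrArg (· w) h.fderiv

theorem eventually_differentiableAt_of_contDiffAt_two (hm : ContDiffAt ℝ 2 m (x, y)) :
    ∀ᶠ p in 𝓝 (x, y), DifferentiableAt ℝ m p :=
  (hm.eventually (by simp)).mono fun _ hp => hp.differentiableAt (by norm_num)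

theorem hasFDerivAt_fderiv_of_contDiffAt_two (hm : ContDiffAt ℝ 2 m (x, y)) :
    HasFDerivAt (fderiv ℝ m) (fderiv ℝ (fderiv ℝ m) (x, y)) (x, y) :=
  ((hm.fderiv_right (m := 1) (by norm_num)).differentiableAt (by norm_num)).hasFDerivAt

theorem fderiv_fderiv_comp_prodMk_right (hm : ContDiffAt ℝ 2 m (x, y)) (v : E) (w : E') :
    fderiv ℝ (fun x' => fderiv ℝ (fun y' => m (x', y')) y w) x v =
      fderiv ℝ (fderiv ℝ m) (x, y) (v, 0) (0, w) := by
  have hpartial : (fun x' => fderiv ℝ (fun y' => m (x', y')) y w) =ᶠ[𝓝 x]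
      fun x' => fderiv ℝ m (x', y) (0, w) :=
    ((Continuous.prodMk_left y).tendsto x |>.eventually
      (eventually_differentiableAt_of_contDiffAt_two hm)).mono
        fun x' hx' => fderiv_comp_prodMk_right hx' w
  have h : HasFDerivAt (fun x' => fderiv ℝ m (x', y))
      ((fderiv ℝ (fderiv ℝ m) (x, y)).comp (.inl ℝ E E')) x :=
    HasFDerivAt.comp (f := fun x' => (x', y)) x (hasFDerivAt_fderiv_of_contDiffAt_two hm)
      (hasFDerivAt_prodMk_left x y)
  rw [hpartial.fderiv_eq, (h.clm_apply (hasFDerivAt_const (0, w) x)).fderiv]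
  simp

theorem fderiv_fderiv_comp_prodMk_left (hm : ContDiffAt ℝ 2 m (x, y)) (v : E) (w : E') :
    fderiv ℝ (fun y' => fderiv ℝ (fun x' => m (x', y')) x v) y w =
      fderiv ℝ (fderiv ℝ m) (x, y) (0, w) (v, 0) := by
  have hpartial : (fun y' => fderiv ℝ (fun x' => m (x', y')) x v) =ᶠ[𝓝 y]
      fun y' => fderiv ℝ m (x, y') (v, 0) :=
    ((Continuous.prodMk_right x).tendsto y |>.eventually
      (eventually_differentiableAt_of_contDiffAt_two hm)).mono
        fun y' hy' => fderiv_comp_prodMk_left hy' v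
  have h : HasFDerivAt (fun y' => fderiv ℝ m (x, y'))
      ((fderiv ℝ (fderiv ℝ m) (x, y)).comp (.inr ℝ E E')) y :=
    HasFDerivAt.comp (f := fun y' => (x, y')) y (hasFDerivAt_fderiv_of_contDiffAt_two hm)
      (hasFDerivAt_prodMk_right x y)
  rw [hpartial.fderiv_eq, (h.clm_apply (hasFDerivAt_const (v, 0) y)).fderiv]
  simp

theorem fderiv_fderiv_partial_comm (hm : ContDiffAt ℝ 2 m (x, y)) (v : E) (w : E') :
    fderiv ℝ (fun x' => fderiv ℝ (fun y' => m (x', y')) y w) x v =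
      fderiv ℝ (fun y' => fderiv ℝ (fun x' => m (x', y')) x v) y w := by
  rw [fderiv_fderiv_comp_prodMk_right hm, fderiv_fderiv_comp_prodMk_left hm,
    (hm.isSymmSndFDerivAt (by simp)).eq]

end PartialDerivatives

theorem lieBracket_leftTranslate_rightTranslate {m : E × E → E} {x : E}
    (hm : ContDiffAt ℝ 2 m (x, x)) (hleft : ∀ᶠ y in 𝓝 x, m (x, y) = y)
    (hright : ∀ᶠ y in 𝓝 x, m (y, x) = y) (v w : E) :
    lieBracket ℝ (fun y => fderiv ℝ (fun z => m (z, y)) x v)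
      (fun y => fderiv ℝ (fun z => m (y, z)) x w) x = 0 := by
  have hv : fderiv ℝ (fun z => m (z, x)) x v = v := by
    rw [EventuallyEq.fderiv_eq (f := fun y => y) hright, fderiv_fun_id]
    rfl
  have hw : fderiv ℝ (fun z => m (x, z)) x w = w := by
    rw [EventuallyEq.fderiv_eq (f := fun y => y) hleft, fderiv_fun_id]
    rfl
  simp only [lieBracket_eq, hv, hw, fderiv_fderiv_partial_comm hm, sub_self]

variable {H : Type*} [TopologicalSpace H] {I : ModelWithCorners ℝ E H}

theorem mfderiv_extChartAt_mfderiv [I.Boundaryless] {M : Type*} [TopologicalSpace M]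
    [ChartedSpace H M] [IsManifold I 1 M] {f : M → M} {x y : M} (hf : MDifferentiableAt I I f x)
    (hfx : f x = y) (hy : y ∈ (extChartAt I x).source) (v : TangentSpace I x) :
    mfderiv I 𝓘(ℝ, E) (extChartAt I x) y (mfderiv I I f x v : TangentSpace I (f x)) =
      fderiv ℝ (fun z => extChartAt I x (f ((extChartAt I x).symm z))) (extChartAt I x x) v := by
  have hchart : MDifferentiableAt I 𝓘(ℝ, E) (extChartAt I x) y :=
    mdifferentiableAt_extChartAt (by rwa [extChartAt_source] at hy)
  have hchartf : MDifferentiableAt I 𝓘(ℝ, E) (extChartAt I x ∘ f) x :=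
    hchart.comp_of_eq x hf hfx
  have hsymm : MDifferentiableAt 𝓘(ℝ, E) I (extChartAt I x).symm (extChartAt I x x) := by
    simpa only [I.range_eq_univ, mdifferentiableWithinAt_univ] using
      mdifferentiableWithinAt_extChartAt_symm (I := I) (mem_extChartAt_target (I := I) x)
  have hsymmv : mfderiv 𝓘(ℝ, E) I (extChartAt I x).symm (extChartAt I x x) v = v := by
    have h := mfderivWithin_range_extChartAt_symm (I := I) (x := x)
    rw [I.range_eq_univ, mfderivWithin_univ] at h
    rw [h]
    rfl
  have hcomp := mfderiv_comp_apply_of_eq (I := 𝓘(ℝ, E)) (g := extChartAt I x ∘ f) _ hchartf hsymm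
    (extChartAt_to_inv x) v
  rw [mfderiv_eq_fderiv, hsymmv] at hcomp
  rw [← mfderiv_comp_apply_of_eq x hchart hf hfx]
  exact hcomp.symm

theorem mpullbackWithin_extChartAt_symm {M : Type*} [TopologicalSpace M] [ChartedSpace H M]
    [IsManifold I 1 M] (V : (x : M) → TangentSpace I x) {x : M} {y : E}
    (hy : y ∈ (extChartAt I x).target) :
    mpullbackWithin 𝓘(ℝ, E) I (extChartAt I x).symm V (range I) y =
      mfderiv I 𝓘(ℝ, E) (extChartAt I x) ((extChartAt I x).symm y)
        (V ((extChartAt I x).symm y)) := by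
  rw [mpullbackWithin_apply, ContinuousLinearMap.inverse_eq
    (mfderivWithin_extChartAt_symm_comp_mfderiv_extChartAt hy)
    (mfderiv_extChartAt_comp_mfderivWithin_extChartAt_symm hy)]
  rfl

variable {G : Type*} [TopologicalSpace G] [ChartedSpace H G] [Group G] [LieGroup I ∞ G]
  [I.Boundaryless]

theorem contDiffAt_extChartAt_mul :
    ContDiffAt ℝ ∞ (fun p : E × E => extChartAt I (1 : G)
      ((extChartAt I (1 : G)).symm p.1 * (extChartAt I (1 : G)).symm p.2))
      (extChartAt I (1 : G) 1, extChartAt I (1 : G) 1) := by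
  have hsymm : ContMDiffAt 𝓘(ℝ, E) I ∞ (extChartAt I (1 : G)).symm (extChartAt I (1 : G) 1) :=
    (contMDiffOn_extChartAt_symm (1 : G)).contMDiffAt (extChartAt_target_mem_nhds (1 : G))
  have hfst : ContMDiffAt 𝓘(ℝ, E × E) I ∞ (fun p : E × E => (extChartAt I (1 : G)).symm p.1)
      (extChartAt I (1 : G) 1, extChartAt I (1 : G) 1) :=
    hsymm.comp (I' := 𝓘(ℝ, E)) (f := Prod.fst) _ contDiffAt_fst.contMDiffAt
  have hsnd : ContMDiffAt 𝓘(ℝ, E × E) I ∞ (fun p : E × E => (extChartAt I (1 : G)).symm p.2)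
      (extChartAt I (1 : G) 1, extChartAt I (1 : G) 1) :=
    hsymm.comp (I' := 𝓘(ℝ, E)) (f := Prod.snd) _ contDiffAt_snd.contMDiffAt
  exact (contMDiffAt_extChartAt.comp_of_eq (hfst.mul hsnd) (by simp)).contDiffAt

theorem lie_eq_zero_of_mulInvariantVectorField_eq {v : GroupLieAlgebra I G}
    (hv : ∀ g, mulInvariantVectorField v g = rightInvariantVectorField I v g)
    (w : GroupLieAlgebra I G) : ⁅v, w⁆ = 0 := by
  set e := extChartAt I (1 : G) with he
  have htarget : ∀ᶠ x in 𝓝 (e 1), x ∈ e.target := extChartAt_target_mem_nhds (1 : G)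
  have hinv : e.symm (e 1) = 1 := extChartAt_to_inv (1 : G)
  have hV : mpullbackWithin 𝓘(ℝ, E) I e.symm (mulInvariantVectorField v) (range I) =ᶠ[𝓝 (e 1)]
      fun x => fderiv ℝ (fun z => e (e.symm z * e.symm x)) (e 1) v :=
    htarget.mono fun x hx => by
      rw [mpullbackWithin_extChartAt_symm _ hx, hv]
      exact mfderiv_extChartAt_mfderiv
        ((contMDiff_mul_right (I := I) (n := ∞)).mdifferentiable (by simp) _) (one_mul _)
        (e.map_target hx) v
  have hW : mpullbackWithin 𝓘(ℝ, E) I e.symm (mulInvariantVectorField w) (range I) =ᶠ[𝓝 (e 1)]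
      fun x => fderiv ℝ (fun z => e (e.symm x * e.symm z)) (e 1) w :=
    htarget.mono fun x hx => by
      rw [mpullbackWithin_extChartAt_symm _ hx]
      exact mfderiv_extChartAt_mfderiv
        ((contMDiff_mul_left (I := I) (n := ∞)).mdifferentiable (by simp) _) (mul_one _)
        (e.map_target hx) w
  have hbracket := lieBracket_leftTranslate_rightTranslate
    ((contDiffAt_extChartAt_mul (I := I) (G := G)).of_le (by norm_cast))
    (htarget.mono fun x hx => by simp only [← he, hinv, one_mul, e.right_inv hx])
    (htarget.mono fun x hx => by simp only [← he, hinv, mul_one, e.right_inv hx]) v w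
  have hpullback := (congrFun lieBracketWithin_univ (e 1)).trans
    ((hV.lieBracket_vectorField_eq hW).trans hbracket)
  rw [GroupLieAlgebra.bracket_def, mlieBracket, mlieBracketWithin_apply, preimage_univ, univ_inter,
    I.range_eq_univ]
  rw [I.range_eq_univ] at hpullback
  exact (congrArg _ hpullback).trans (map_zero _)

end LieBracket

section PartialTangentMap

variable {E : Type*} [NormedAddCommGroup E] [NormedSpace ℝ E]
  {H : Type*} [TopologicalSpace H] {I : ModelWithCorners ℝ E H}
  {M : Type*} [TopologicalSpace M] [ChartedSpace H M]
  {E' : Type*} [NormedAddCommGroup E'] [NormedSpace ℝ E']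
  {H' : Type*} [TopologicalSpace H'] {I' : ModelWithCorners ℝ E' H'}
  {M' : Type*} [TopologicalSpace M'] [ChartedSpace H' M']
  {E'' : Type*} [NormedAddCommGroup E''] [NormedSpace ℝ E'']
  {H'' : Type*} [TopologicalSpace H''] {J : ModelWithCorners ℝ E'' H''}
  {N : Type*} [TopologicalSpace N] [ChartedSpace H'' N]
  [IsManifold I 1 M] [IsManifold I' 1 M'] [IsManifold J 1 N]

theorem contMDiff_mfderiv_prodMk_right_apply {m n : ℕ∞ω} {F : M × M' → N}
    (hF : ContMDiff (I.prod I') J n F) (hmn : m + 1 ≤ n) (y : M') (v : TangentSpace I' y) :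
    ContMDiff I J.tangent m fun x =>
      (⟨F (x, y), mfderiv I' J (fun y' => F (x, y')) y v⟩ : TangentBundle J N) := by
  have hsection : ContMDiff I (I.tangent.prod I'.tangent) m fun x =>
      ((⟨x, 0⟩, ⟨y, v⟩) : TangentBundle I M × TangentBundle I' M') :=
    (Bundle.contMDiff_zeroSection ℝ (TangentSpace I : M → Type _)).prodMk contMDiff_const
  have hcomp := ((hF.contMDiff_tangentMap hmn).comp
    contMDiff_equivTangentBundleProd_symm).comp hsection
  refine hcomp.congr fun x => Bundle.TotalSpace.ext rfl (heq_of_eq ?_)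
  simp only [Function.comp_apply, tangentMap]
  have hn : n ≠ 0 := (zero_lt_one.trans_le (le_add_self.trans hmn)).ne'
  rw [mfderiv_prod_eq_add_apply (hF.mdifferentiableAt hn)]
  exact ((congrArg (· + _) (map_zero _)).trans (zero_add _)).symm

end PartialTangentMap

section IntegralCurveImage

variable {E : Type*} [NormedAddCommGroup E] [NormedSpace ℝ E]
  {H : Type*} [TopologicalSpace H] {I : ModelWithCorners ℝ E H}
  {M : Type*} [TopologicalSpace M] [ChartedSpace H M]
  {E' : Type*} [NormedAddCommGroup E'] [NormedSpace ℝ E']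
  {H' : Type*} [TopologicalSpace H'] {I' : ModelWithCorners ℝ E' H'}
  {M' : Type*} [TopologicalSpace M'] [ChartedSpace H' M']
  {V : (x : M) → TangentSpace I x} {W : (x : M') → TangentSpace I' x} {f : M → M'} {γ : ℝ → M}

theorem isMIntegralCurveOn_comp_of_mfderiv_eq {s : Set ℝ} (hf : MDifferentiable I I' f)
    (hVW : ∀ x, mfderiv I I' f x (V x) = W (f x)) (hγ : IsMIntegralCurveOn γ V s) :
    IsMIntegralCurveOn (fun t => f (γ t)) W s := by
  intro t ht
  refine ((hf (γ t)).hasMFDerivAt.comp_hasMFDerivWithinAt t (hγ t ht)).congr_mfderiv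
    (ContinuousLinearMap.ext fun c : ℝ => ?_)
  exact (map_smul (mfderiv I I' f (γ t)) c (V (γ t))).trans (congrArg (c • ·) (hVW _))

theorem isMIntegralCurve_comp_of_mfderiv_eq (hf : MDifferentiable I I' f)
    (hVW : ∀ x, mfderiv I I' f x (V x) = W (f x)) (hγ : IsMIntegralCurve γ V) :
    IsMIntegralCurve (fun t => f (γ t)) W := by
  rw [isMIntegralCurve_iff_isMIntegralCurveOn] at *
  exact isMIntegralCurveOn_comp_of_mfderiv_eq hf hVW hγ

end IntegralCurveImage

section LocallyConstant

variable {E : Type*} [NormedAddCommGroup E] [NormedSpace ℝ E]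
  {H : Type*} [TopologicalSpace H] {I : ModelWithCorners ℝ E H} [I.Boundaryless]
  {M : Type*} [TopologicalSpace M] [ChartedSpace H M] [IsManifold I 1 M]
  {E' : Type*} [NormedAddCommGroup E'] [NormedSpace ℝ E']
  {H' : Type*} [TopologicalSpace H'] {I' : ModelWithCorners ℝ E' H'}
  {N : Type*} [TopologicalSpace N] [ChartedSpace H' N] [IsManifold I' 1 N] {k : M → N}

theorem hasFDerivAt_zero_extChartAt_comp {x : M} {y : N} {z : E}
    (hz : z ∈ (extChartAt I x).target)
    (hkz : k ((extChartAt I x).symm z) ∈ (extChartAt I' y).source)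
    (hk : HasMFDerivAt I I' k ((extChartAt I x).symm z) 0) :
    HasFDerivAt (fun z => extChartAt I' y (k ((extChartAt I x).symm z))) (0 : E →L[ℝ] E') z := by
  have hsymm := mdifferentiableWithinAt_extChartAt_symm (I := I) hz
  rw [I.range_eq_univ, mdifferentiableWithinAt_univ] at hsymm
  have hchart := (mdifferentiableAt_extChartAt (I := I') (x := y)
    (by rwa [extChartAt_source] at hkz)).hasMFDerivAt
  have h := (hchart.comp z (hk.comp z hsymm.hasMFDerivAt)).hasFDerivAt
  exact h.congr_fderiv ((congrArg _ (ContinuousLinearMap.zero_comp _)).trans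
    (ContinuousLinearMap.comp_zero _))

theorem isLocallyConstant_of_hasMFDerivAt_zero (hk : ∀ x, HasMFDerivAt I I' k x 0) :
    IsLocallyConstant k := by
  rw [IsLocallyConstant.iff_eventually_eq]
  intro x
  set e := extChartAt I x
  have hkcont : ContinuousAt (fun z => k (e.symm z)) (e x) :=
    ContinuousAt.comp_of_eq (hk x).continuousAt (continuousAt_extChartAt_symm x) (by simp [e])
  have hcharts : ∀ᶠ z in 𝓝 (e x),
      z ∈ e.target ∧ k (e.symm z) ∈ (extChartAt I' (k x)).source := by
    refine Eventually.and (extChartAt_target_mem_nhds x) (hkcont.eventually ?_)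
    simpa only [e, extChartAt_to_inv] using! extChartAt_source_mem_nhds (I := I') (k x)
  obtain ⟨ε, hε, hball⟩ := Metric.eventually_nhds_iff_ball.1 hcharts
  have hderiv (z : E) (hz : z ∈ Metric.ball (e x) ε) :
      HasFDerivAt (fun z => extChartAt I' (k x) (k (e.symm z))) (0 : E →L[ℝ] E') z :=
    hasFDerivAt_zero_extChartAt_comp (hball z hz).1 (hball z hz).2 (hk _)
  filter_upwards [(continuousAt_extChartAt x).eventually (Metric.ball_mem_nhds (e x) hε),
    extChartAt_source_mem_nhds (I := I) x] with y hy hys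
  have hconst := Metric.isOpen_ball.is_const_of_fderiv_eq_zero (𝕜 := ℝ)
    (convex_ball (e x) ε).isPreconnected
    (fun z hz => (hderiv z hz).differentiableAt.differentiableWithinAt)
    (fun z hz => (hderiv z hz).fderiv) hy (Metric.mem_ball_self hε)
  have hky := (hball _ hy).2
  rw [e.left_inv hys] at hconst hky
  rw [extChartAt_to_inv] at hconst
  exact (extChartAt I' (k x)).injOn hky (mem_extChartAt_source _) hconst

end LocallyConstant

section OneParameterSubgroup

variable {E : Type*} [NormedAddCommGroup E] [NormedSpace ℝ E]
  {H : Type*} [TopologicalSpace H] {I : ModelWithCorners ℝ E H}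
  {G : Type*} [TopologicalSpace G] [ChartedSpace H G] [Group G]

theorem rightInvariantVectorField_one (v : GroupLieAlgebra I G) :
    rightInvariantVectorField I v 1 = v := by
  have h : (fun x : G => x * 1) = id := funext mul_one
  unfold rightInvariantVectorField
  rw [h, mfderiv_id]
  rfl

theorem rightInvariantVectorField_smul (c : ℝ) (v : GroupLieAlgebra I G) (g : G) :
    rightInvariantVectorField I (c • v) g = c • rightInvariantVectorField I v g :=
  map_smul (mfderiv I I (fun x : G => x * g) 1) c v

variable [LieGroup I ∞ G]

theorem mdifferentiable_mul_right_const (g : G) : MDifferentiable I I (fun x : G => x * g) :=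
  (contMDiff_mul_right (I := I) (n := ∞)).mdifferentiable (by simp)

theorem mfderiv_mul_right_rightInvariantVectorField (v : GroupLieAlgebra I G) (g h : G) :
    mfderiv I I (fun x => x * h) g (rightInvariantVectorField I v g) =
      rightInvariantVectorField I v (g * h) := by
  have hcomp := mfderiv_comp_apply_of_eq (I := I) (I' := I) (I'' := I) (f := fun x : G => x * g)
    (g := fun x : G => x * h) 1 (mdifferentiable_mul_right_const h g)
    (mdifferentiable_mul_right_const g 1) (one_mul g) v
  have hfun : (fun x : G => x * h) ∘ (fun x : G => x * g) = fun x => x * (g * h) :=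
    funext fun x => mul_assoc x g h
  rw [hfun] at hcomp
  exact hcomp.symm

theorem isMIntegralCurve_mul_right {v : GroupLieAlgebra I G} {γ : ℝ → G}
    (hγ : IsMIntegralCurve γ (rightInvariantVectorField I v)) (g : G) :
    IsMIntegralCurve (fun t => γ t * g) (rightInvariantVectorField I v) :=
  isMIntegralCurve_comp_of_mfderiv_eq (mdifferentiable_mul_right_const g)
    (fun x => mfderiv_mul_right_rightInvariantVectorField v x g) hγ

theorem contMDiff_rightInvariantVectorField (v : GroupLieAlgebra I G) :
    ContMDiff I I.tangent 1
      (fun g : G => (⟨g, rightInvariantVectorField I v g⟩ : TangentBundle I G)) := by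
  have hmul : ContMDiff (I.prod I) I ∞ fun p : G × G => p.2 * p.1 :=
    contMDiff_snd.mul contMDiff_fst
  convert! contMDiff_mfderiv_prodMk_right_apply hmul (m := 1) (by norm_cast) (1 : G) v with g
  exact (one_mul g).symm

variable [I.Boundaryless] [T2Space G] [CompleteSpace E]

theorem exists_isMIntegralCurve_rightInvariantVectorField (v : GroupLieAlgebra I G) :
    ∃ γ : ℝ → G, γ 0 = 1 ∧ IsMIntegralCurve γ (rightInvariantVectorField I v) := by
  have hv := contMDiff_rightInvariantVectorField v
  obtain ⟨γ, hγ0, hγ⟩ := exists_isMIntegralCurveAt_of_contMDiffAt_boundaryless (t₀ := 0)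
    (hv.contMDiffAt (x := 1))
  obtain ⟨ε, hε, hγ⟩ := isMIntegralCurveAt_iff'.1 hγ
  rw [Real.ball_eq_Ioo, zero_sub, zero_add] at hγ
  -- Right translation carries the local solution at `1` to one at `g` living equally long.
  exact exists_isMIntegralCurve_of_isMIntegralCurveOn hv hε
    (fun g => ⟨fun t => γ t * g, by simp [hγ0],
      isMIntegralCurveOn_comp_of_mfderiv_eq (mdifferentiable_mul_right_const g)
        (fun x => mfderiv_mul_right_rightInvariantVectorField v x g) hγ⟩) 1

theorem lieGroupExp_smul_eq {v : GroupLieAlgebra I G} {γ : ℝ → G} (hγ0 : γ 0 = 1)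
    (hγ : IsMIntegralCurve γ (rightInvariantVectorField I v)) (t : ℝ) :
    lieGroupExp I (t • v) = γ t := by
  have hspec := Classical.epsilon_spec (exists_isMIntegralCurve_rightInvariantVectorField (t • v))
  have hscale : IsMIntegralCurve (γ ∘ (· * t)) (rightInvariantVectorField I (t • v)) := by
    convert hγ.comp_mul t using 1
    ext g
    exact rightInvariantVectorField_smul t v g
  have heq := isMIntegralCurve_Ioo_eq_of_contMDiff_boundaryless (t₀ := 0)
    (contMDiff_rightInvariantVectorField (t • v)) hspec.2 hscale
    (by rw [hspec.1, Function.comp_apply, zero_mul, hγ0])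
  exact (congrFun heq 1).trans (by simp)

theorem isMIntegralCurve_lieGroupExp (v : GroupLieAlgebra I G) :
    IsMIntegralCurve (fun t : ℝ => lieGroupExp I (t • v)) (rightInvariantVectorField I v) := by
  obtain ⟨γ, hγ0, hγ⟩ := exists_isMIntegralCurve_rightInvariantVectorField v
  rwa [funext fun t => lieGroupExp_smul_eq hγ0 hγ t]

theorem lieGroupExp_zero : lieGroupExp I (0 : GroupLieAlgebra I G) = 1 := by
  obtain ⟨γ, hγ0, hγ⟩ :=
    exists_isMIntegralCurve_rightInvariantVectorField (0 : GroupLieAlgebra I G)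
  rw [← hγ0, ← lieGroupExp_smul_eq hγ0 hγ, smul_zero]
  rfl

theorem lieGroupExp_add_smul (v : GroupLieAlgebra I G) (s t : ℝ) :
    lieGroupExp I ((s + t) • v) = lieGroupExp I (s • v) * lieGroupExp I (t • v) := by
  have hcurve := isMIntegralCurve_lieGroupExp v
  have heq := isMIntegralCurve_Ioo_eq_of_contMDiff_boundaryless (t₀ := 0)
    (contMDiff_rightInvariantVectorField v) (hcurve.comp_add t)
    (isMIntegralCurve_mul_right hcurve (lieGroupExp I (t • v))) (by simp [lieGroupExp_zero])
  exact congrFun heq s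

theorem isFlowOf_lieGroupExp (v : GroupLieAlgebra I G) :
    IsFlowOf I (rightInvariantVectorField I v) (fun t g => lieGroupExp I (t • v) * g) where
  map_zero g := by rw [zero_smul, lieGroupExp_zero, one_mul]
  isMIntegralCurve g := isMIntegralCurve_mul_right (isMIntegralCurve_lieGroupExp v) g

theorem eq_of_forall_lieGroupExp_smul_eq {v w : GroupLieAlgebra I G}
    (h : ∀ t : ℝ, lieGroupExp I (t • v) = lieGroupExp I (t • w)) : v = w := by
  have hzero (u : GroupLieAlgebra I G) (g : G) (hg : g = 1) :
      (rightInvariantVectorField I u g : E) = u := by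
    subst hg
    exact rightInvariantVectorField_one u
  have hvelocity (u : GroupLieAlgebra I G) : HasMFDerivAt 𝓘(ℝ, ℝ) I
      (fun t : ℝ => lieGroupExp I (t • u)) 0 ((1 : ℝ →L[ℝ] ℝ).smulRight (u : E)) := by
    refine (isMIntegralCurve_lieGroupExp u 0).congr_mfderiv ?_
    exact congrArg (fun u : E => (1 : ℝ →L[ℝ] ℝ).smulRight u)
      (hzero u _ (by simp [lieGroupExp_zero]))
  have hw := hvelocity w
  rw [← funext h] at hw
  have hone : (1 : ℝ) • (v : E) = (1 : ℝ) • (w : E) :=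
    congrArg (fun L : ℝ →L[ℝ] E => L 1) (hasMFDerivAt_unique (hvelocity v) hw)
  rwa [one_smul, one_smul] at hone

end OneParameterSubgroup

section LieDifferential

variable {E : Type*} [NormedAddCommGroup E] [NormedSpace ℝ E]
  {H : Type*} [TopologicalSpace H] {I : ModelWithCorners ℝ E H}
  {G : Type*} [TopologicalSpace G] [ChartedSpace H G] [Group G]
  {E' : Type*} [NormedAddCommGroup E'] [NormedSpace ℝ E']
  {H' : Type*} [TopologicalSpace H'] {I' : ModelWithCorners ℝ E' H'}
  {G' : Type*} [TopologicalSpace G'] [ChartedSpace H' G'] [Group G']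
  {E'' : Type*} [NormedAddCommGroup E''] [NormedSpace ℝ E'']
  {H'' : Type*} [TopologicalSpace H''] {I'' : ModelWithCorners ℝ E'' H''}
  {G'' : Type*} [TopologicalSpace G''] [ChartedSpace H'' G''] [Group G'']

variable (I I') in
/-- The differential at the identity of a homomorphism of Lie groups, as a map of Lie algebras. It
is defined for every map `f`, and is meaningful when `f 1 = 1`: the tangent space at `f 1` is
silently identified with the one at `1`. -/
noncomputable def lieDifferential (f : G → G') : GroupLieAlgebra I G →L[ℝ] GroupLieAlgebra I' G' :=
  (mfderiv I I' f 1 : E →L[ℝ] E')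

theorem lieDifferential_id : lieDifferential I I (id : G → G) = ContinuousLinearMap.id ℝ _ :=
  mfderiv_id

theorem lieDifferential_comp {f : G' → G''} {h : G → G'} (hf : MDifferentiable I' I'' f)
    (hh : MDifferentiable I I' h) (h1 : h 1 = 1) :
    lieDifferential I I'' (f ∘ h) = (lieDifferential I' I'' f).comp (lieDifferential I I' h) := by
  ext v
  exact mfderiv_comp_apply_of_eq 1 (hf 1) (hh 1) h1 v

variable [LieGroup I' ∞ G']

theorem hasMFDerivAt_inv_mul_zero {f f' : G →* G'} (hf : MDifferentiable I I' f)
    (hf' : MDifferentiable I I' f') (hff' : lieDifferential I I' f = lieDifferential I I' f') :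
    HasMFDerivAt I I' (fun x => (f x)⁻¹ * f' x) 1 0 := by
  have hdiff : MDifferentiable (I'.prod I') I' fun p : G' × G' => p.1⁻¹ * p.2 :=
    (ContMDiff.mul (n := ∞) contMDiff_fst.inv contMDiff_snd).mdifferentiable (by simp)
  let L : E' × E' →L[ℝ] E' := mfderiv (I'.prod I') I' (fun p : G' × G' => p.1⁻¹ * p.2) (f 1, f 1)
  have hL : HasMFDerivAt (I'.prod I') I' (fun p : G' × G' => p.1⁻¹ * p.2) (f 1, f 1) L :=
    (hdiff _).hasMFDerivAt
  have hL' : HasMFDerivAt (I'.prod I') I' (fun p : G' × G' => p.1⁻¹ * p.2) (f 1, f' 1) L := by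
    rw [map_one f', ← map_one f]
    exact hL
  let D : E →L[ℝ] E' := mfderiv I I' f 1
  have hD : HasMFDerivAt I I' f 1 D := (hf 1).hasMFDerivAt
  have hD' : HasMFDerivAt I I' f' 1 D := (hf' 1).hasMFDerivAt.congr_mfderiv hff'.symm
  have hzero : L.comp (D.prod D) = 0 := by
    have hcomp := HasMFDerivAt.comp (f := fun x => (f x, f x)) 1 hL (hD.prodMk hD)
    have hconst : (fun p : G' × G' => p.1⁻¹ * p.2) ∘ (fun x => (f x, f x)) = fun _ => 1 :=
      funext fun x => inv_mul_cancel (f x)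
    rw [hconst] at hcomp
    exact hasMFDerivAt_unique hcomp (hasMFDerivAt_const 1 1)
  exact (HasMFDerivAt.comp (f := fun x => (f x, f' x)) 1 hL' (hD.prodMk hD')).congr_mfderiv hzero

variable [LieGroup I ∞ G]

theorem mfderiv_rightInvariantVectorField {f : G →* G'} (hf : MDifferentiable I I' f)
    (v : GroupLieAlgebra I G) (g : G) :
    mfderiv I I' f g (rightInvariantVectorField I v g) =
      rightInvariantVectorField I' (lieDifferential I I' f v) (f g) := by
  have hleft := mfderiv_comp_apply_of_eq (I := I) (I' := I) (I'' := I') (f := fun x : G => x * g)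
    (g := f) 1 (hf g) (mdifferentiable_mul_right_const g 1) (one_mul g) v
  have hright := mfderiv_comp_apply_of_eq (I := I) (I' := I') (I'' := I') (f := f)
    (g := fun x : G' => x * f g) 1 (mdifferentiable_mul_right_const (f g) 1) (hf 1) (map_one f) v
  have hfun : f ∘ (fun x : G => x * g) = (fun x : G' => x * f g) ∘ f :=
    funext fun x => map_mul f x g
  rw [hfun] at hleft
  exact hleft.symm.trans hright

theorem map_lieGroupExp [I.Boundaryless] [T2Space G] [CompleteSpace E] [I'.Boundaryless]
    [T2Space G'] [CompleteSpace E'] {f : G →* G'} (hf : MDifferentiable I I' f)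
    (v : GroupLieAlgebra I G) :
    f (lieGroupExp I v) = lieGroupExp I' (lieDifferential I I' f v) := by
  have h := lieGroupExp_smul_eq (γ := fun t : ℝ => f (lieGroupExp I (t • v)))
    (by rw [zero_smul, lieGroupExp_zero, map_one])
    (isMIntegralCurve_comp_of_mfderiv_eq hf (mfderiv_rightInvariantVectorField hf v)
      (isMIntegralCurve_lieGroupExp v)) 1
  rw [one_smul, one_smul] at h
  exact h.symm

theorem hasMFDerivAt_zero_of_apply_mul {k : G → G'} {g : G} {a b : G'}
    (hk : ∀ x, k (x * g) = a * k x * b) (hk1 : HasMFDerivAt I I' k 1 0) :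
    HasMFDerivAt I I' k g 0 := by
  have htranslate := (mdifferentiable_mul_right_const (I := I) g⁻¹ g).hasMFDerivAt
  have hk1' : HasMFDerivAt I I' k (g * g⁻¹) (0 : E →L[ℝ] E') := by
    rw [mul_inv_cancel]
    exact hk1
  have houter : MDifferentiable I' I' (fun y : G' => a * y * b) :=
    ((contMDiff_mul_right (I := I') (n := ∞)).comp
      (contMDiff_mul_left (I := I') (n := ∞))).mdifferentiable (by simp)
  have hcomp := (houter _).hasMFDerivAt.comp g (hk1'.comp g htranslate)
  have hfun : (fun y : G' => a * y * b) ∘ k ∘ (fun x => x * g⁻¹) = k :=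
    funext fun x => by simp [← hk]
  rw [hfun] at hcomp
  exact hcomp.congr_mfderiv ((congrArg _ (ContinuousLinearMap.zero_comp _)).trans
    (ContinuousLinearMap.comp_zero _))

theorem eq_of_lieDifferential_eq [I.Boundaryless] [PreconnectedSpace G] {f f' : G →* G'}
    (hf : MDifferentiable I I' f) (hf' : MDifferentiable I I' f')
    (hff' : lieDifferential I I' f = lieDifferential I I' f') : f = f' := by
  have hderiv (g : G) : HasMFDerivAt I I' (fun x => (f x)⁻¹ * f' x) g 0 :=
    hasMFDerivAt_zero_of_apply_mul (a := (f g)⁻¹) (b := f' g) (fun x => by simp [mul_assoc])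
      (hasMFDerivAt_inv_mul_zero hf hf' hff')
  ext g
  have hconst := (isLocallyConstant_of_hasMFDerivAt_zero hderiv).apply_eq_of_preconnectedSpace g 1
  rwa [map_one, map_one, inv_one, one_mul, inv_mul_eq_one] at hconst

end LieDifferential

section Adjoint

variable {E : Type*} [NormedAddCommGroup E] [NormedSpace ℝ E]
  {H : Type*} [TopologicalSpace H] {I : ModelWithCorners ℝ E H}
  {G : Type*} [TopologicalSpace G] [ChartedSpace H G] [Group G] [LieGroup I ∞ G]

theorem mdifferentiable_conj (g : G) : MDifferentiable I I (MulAut.conj g : G → G) :=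
  ((contMDiff_mul_right (I := I) (n := ∞) (a := g⁻¹)).comp
    (contMDiff_mul_left (I := I) (n := ∞) (a := g))).mdifferentiable (by simp)

variable (I G) in
/-- The adjoint representation of a Lie group on its Lie algebra. -/
noncomputable def lieAd : G →* Module.End ℝ (GroupLieAlgebra I G) where
  toFun g := (lieDifferential I I (MulAut.conj g : G → G) : _ →L[ℝ] _)
  map_one' := by
    have hconj : (MulAut.conj (1 : G) : G → G) = id := by ext; simp
    rw [hconj, lieDifferential_id]
    rfl
  map_mul' g h := by
    have hconj : (MulAut.conj (g * h) : G → G) = MulAut.conj g ∘ MulAut.conj h := by ext; simp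
    rw [hconj, lieDifferential_comp (mdifferentiable_conj g) (mdifferentiable_conj h) (map_one _)]
    rfl

theorem continuous_lieAd_apply (v : GroupLieAlgebra I G) :
    Continuous fun g => lieAd I G g v := by
  have hconj : ContMDiff (I.prod I) I ∞ fun p : G × G => p.1 * p.2 * p.1⁻¹ :=
    (contMDiff_fst.mul contMDiff_snd).mul contMDiff_fst.inv
  rw [(FiberBundle.totalSpaceMk_isInducing E (TangentSpace I) (1 : G)).continuous_iff]
  convert! (contMDiff_mfderiv_prodMk_right_apply hconj (m := 0) (by norm_cast) (1 : G) v).continuous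
    using 2 with g
  exact Bundle.TotalSpace.ext (by simp) HEq.rfl

theorem mulInvariantVectorField_eq_of_lieAd_fixed {v : GroupLieAlgebra I G}
    (hv : ∀ g, lieAd I G g v = v) (g : G) :
    mulInvariantVectorField v g = rightInvariantVectorField I v g := by
  have hcomp := mfderiv_comp_apply_of_eq (I := I) (I' := I) (I'' := I)
    (f := (MulAut.conj g : G → G)) (g := fun x : G => x * g) 1
    (mdifferentiable_mul_right_const g 1) (mdifferentiable_conj g 1) (map_one _) v
  have hfun : (fun x : G => x * g) ∘ (MulAut.conj g : G → G) = fun x => g * x := by ext; simp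
  rw [hfun] at hcomp
  exact hcomp.trans (congrArg (fun u : GroupLieAlgebra I G =>
    (mfderiv I I (fun x : G => x * g) 1 u : E)) (hv g))

theorem mem_center_of_lieAd_fixed [I.Boundaryless] [CompleteSpace E] {v : GroupLieAlgebra I G}
    (hv : ∀ g, lieAd I G g v = v) : v ∈ LieAlgebra.center ℝ (GroupLieAlgebra I G) := by
  rw [LieModule.mem_maxTrivSubmodule]
  intro w
  rw [← lie_skew, lie_eq_zero_of_mulInvariantVectorField_eq
    (mulInvariantVectorField_eq_of_lieAd_fixed hv), neg_zero]

theorem mem_center_of_lieAd_eq_one [I.Boundaryless] [PreconnectedSpace G] {c : G}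
    (hc : lieAd I G c = 1) : c ∈ Subgroup.center G := by
  have hconj : (MulAut.conj c).toMonoidHom = MonoidHom.id G :=
    eq_of_lieDifferential_eq (I := I) (I' := I) (mdifferentiable_conj c) mdifferentiable_id
      (ContinuousLinearMap.ext fun v => (congrArg (fun L : Module.End ℝ _ => L v) hc).trans
        (congrArg (fun L => L v) lieDifferential_id).symm)
  refine Subgroup.mem_center_iff.2 fun g => ?_
  have hg : c * g * c⁻¹ = g := DFunLike.congr_fun hconj g
  exact (mul_inv_eq_iff_eq_mul.1 hg).symm

theorem conj_lieGroupExp [I.Boundaryless] [T2Space G] [CompleteSpace E] (g : G)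
    (v : GroupLieAlgebra I G) :
    g * lieGroupExp I v * g⁻¹ = lieGroupExp I (lieAd I G g v) :=
  map_lieGroupExp (f := (MulAut.conj g).toMonoidHom) (mdifferentiable_conj g) v

end Adjoint

section Flow

variable {E : Type*} [NormedAddCommGroup E] [NormedSpace ℝ E]
  {H : Type*} [TopologicalSpace H] {I : ModelWithCorners ℝ E H} [I.Boundaryless]
  {G : Type*} [TopologicalSpace G] [T2Space G] [ChartedSpace H G] [IsManifold I 1 G]
  {V : (g : G) → TangentSpace I g} {φ φ' : ℝ → G → G}

namespace IsFlowOf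

theorem unique (hV : ContMDiff I I.tangent 1 (fun g : G => (⟨g, V g⟩ : TangentBundle I G)))
    (hφ : IsFlowOf I V φ) (hφ' : IsFlowOf I V φ') : φ = φ' := by
  ext t g
  exact congrFun (isMIntegralCurve_Ioo_eq_of_contMDiff_boundaryless (t₀ := 0) hV
    (hφ.isMIntegralCurve g) (hφ'.isMIntegralCurve g) (by rw [hφ.map_zero, hφ'.map_zero])) t

theorem add_apply (hV : ContMDiff I I.tangent 1 (fun g : G => (⟨g, V g⟩ : TangentBundle I G)))
    (hφ : IsFlowOf I V φ) (s t : ℝ) (g : G) : φ (s + t) g = φ s (φ t g) :=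
  congrFun (isMIntegralCurve_Ioo_eq_of_contMDiff_boundaryless (t₀ := 0) hV
    ((hφ.isMIntegralCurve g).comp_add t) (hφ.isMIntegralCurve (φ t g)) (by simp [hφ.map_zero])) s

theorem fixed_or_isPeriodicOrbit
    (hV : ContMDiff I I.tangent 1 (fun g : G => (⟨g, V g⟩ : TangentBundle I G)))
    (hφ : IsFlowOf I V φ) {T : ℝ} (hT : 0 < T) {g : G} (hφT : φ T g = g) :
    (∀ t, φ t g = g) ∨ IsPeriodicOrbit fun t => φ t g := by
  refine or_iff_not_imp_left.2 fun hmoves => ⟨?_, T, hT, fun t => ?_⟩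
  · simpa only [hφ.map_zero, not_forall] using hmoves
  · beta_reduce
    rw [hφ.add_apply hV, hφT]

end IsFlowOf

end Flow

section Periods

theorem continuous_trace_comp {X : Type*} [TopologicalSpace X] {V : Type*} [AddCommGroup V]
    [Module ℝ V] [TopologicalSpace V] [IsTopologicalAddGroup V] [ContinuousSMul ℝ V] [T2Space V]
    [FiniteDimensional ℝ V] {L : X → Module.End ℝ V} (hL : ∀ v, Continuous fun t => L t v) :
    Continuous fun t => LinearMap.trace ℝ V (L t) := by
  let b := finBasis ℝ V
  simp only [LinearMap.trace_eq_matrix_trace ℝ b, trace, diag, LinearMap.toMatrix_apply]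
  exact continuous_finsetSum _ fun i _ =>
    (b.coord i).continuous_of_finiteDimensional.comp (hL (b i))

variable {E : Type*} [NormedAddCommGroup E] [NormedSpace ℝ E]
  {H : Type*} [TopologicalSpace H] {I : ModelWithCorners ℝ E H}
  {G : Type*} [TopologicalSpace G] [T2Space G] [ChartedSpace H G] [Group G] [LieGroup I ∞ G]

theorem exists_isInnerProduct_lieAd [FiniteDimensional ℝ E] [CompactSpace G] :
    ∃ B : LinearMap.BilinForm ℝ (GroupLieAlgebra I G), IsInnerProduct B ∧
      ∀ g v w, B (lieAd I G g v) (lieAd I G g w) = B v w := by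
  have : IsTopologicalGroup G := topologicalGroup_of_lieGroup I ∞
  have : T2Space (GroupLieAlgebra I G) := inferInstanceAs (T2Space E)
  have : FiniteDimensional ℝ (GroupLieAlgebra I G) := inferInstanceAs (FiniteDimensional ℝ E)
  exact exists_isInnerProduct_invariant (lieAd I G) continuous_lieAd_apply

variable [I.Boundaryless] [CompleteSpace E] {v w x y : GroupLieAlgebra I G}

/-- The group of periods of the one-parameter subgroup `t ↦ exp (t • v)`. -/
noncomputable def expPeriods (v : GroupLieAlgebra I G) : AddSubgroup ℝ where
  carrier := {t | lieGroupExp I (t • v) = 1}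
  zero_mem' := by simp [lieGroupExp_zero]
  add_mem' {s t} (hs : lieGroupExp I (s • v) = 1) (ht : lieGroupExp I (t • v) = 1) :=
    (lieGroupExp_add_smul v s t).trans (by rw [hs, ht, one_mul])
  neg_mem' {t} (ht : lieGroupExp I (t • v) = 1) := by
    have h := lieGroupExp_add_smul v (-t) t
    rw [neg_add_cancel, zero_smul, lieGroupExp_zero, ht, mul_one] at h
    exact h.symm

theorem mem_expPeriods {t : ℝ} : t ∈ expPeriods v ↔ lieGroupExp I (t • v) = 1 :=
  Iff.rfl

theorem continuous_lieGroupExp_smul (v : GroupLieAlgebra I G) :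
    Continuous fun t : ℝ => lieGroupExp I (t • v) :=
  (isMIntegralCurve_lieGroupExp v).continuous

theorem isClosed_expPeriods (v : GroupLieAlgebra I G) : IsClosed (expPeriods v : Set ℝ) :=
  isClosed_singleton.preimage (continuous_lieGroupExp_smul v)

theorem expPeriods_eq_top_iff : expPeriods v = ⊤ ↔ v = 0 := by
  simp only [AddSubgroup.eq_top_iff', mem_expPeriods]
  refine ⟨fun h => eq_of_forall_lieGroupExp_smul_eq fun t => ?_, ?_⟩
  · rw [h, smul_zero, lieGroupExp_zero]
  · rintro rfl t
    rw [smul_zero, lieGroupExp_zero]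

theorem mem_expPeriods_smul {c s : ℝ} : s ∈ expPeriods (c • v) ↔ c * s ∈ expPeriods v := by
  rw [mem_expPeriods, mem_expPeriods, smul_smul, mul_comm]

theorem eq_one_of_expPeriods_smul_eq (hv : v ≠ 0) {T c : ℝ} (hT : 0 < T)
    (hTv : T ∈ expPeriods v) (hc : 0 < c) (h : expPeriods (c • v) = expPeriods v) : c = 1 :=
  eq_one_of_scaling_closed_addSubgroup (isClosed_expPeriods v) (mt expPeriods_eq_top_iff.1 hv) hT
    hTv hc fun s => by rw [← mem_expPeriods_smul, h]

theorem expPeriods_lieDifferential {f : G →* G} (hf : MDifferentiable I I f)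
    (hinj : Function.Injective f) (v : GroupLieAlgebra I G) :
    expPeriods (lieDifferential I I f v) = expPeriods v := by
  ext t
  rw [mem_expPeriods, mem_expPeriods, ← map_smul, ← map_lieGroupExp hf, map_eq_one_iff f hinj]

theorem expPeriods_lieAd (g : G) (v : GroupLieAlgebra I G) :
    expPeriods (lieAd I G g v) = expPeriods v :=
  expPeriods_lieDifferential (f := (MulAut.conj g).toMonoidHom) (mdifferentiable_conj g)
    (MulAut.conj g).injective v

theorem lieAd_lieGroupExp_smul_self (t : ℝ) (v : GroupLieAlgebra I G) :
    lieAd I G (lieGroupExp I (t • v)) v = v := by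
  refine eq_of_forall_lieGroupExp_smul_eq fun s => ?_
  rw [← map_smul, ← conj_lieGroupExp, ← lieGroupExp_add_smul, add_comm, lieGroupExp_add_smul,
    mul_inv_cancel_right]

theorem mem_center_of_lieAd_lieGroupExp_eq_one [PreconnectedSpace G]
    (h : ∀ t : ℝ, lieAd I G (lieGroupExp I (t • v)) = 1) :
    v ∈ LieAlgebra.center ℝ (GroupLieAlgebra I G) := by
  refine mem_center_of_lieAd_fixed fun g => eq_of_forall_lieGroupExp_smul_eq fun s => ?_
  rw [← map_smul, ← conj_lieGroupExp, Subgroup.mem_center_iff.1 (mem_center_of_lieAd_eq_one (h s)),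
    mul_inv_cancel_right]

end Periods

section AdjointRotations

variable {E : Type*} [NormedAddCommGroup E] [NormedSpace ℝ E] [CompleteSpace E]
  {H : Type*} [TopologicalSpace H] {I : ModelWithCorners ℝ E H} [I.Boundaryless]
  {G : Type*} [TopologicalSpace G] [T2Space G] [ChartedSpace H G] [Group G] [LieGroup I ∞ G]
  {B : LinearMap.BilinForm ℝ (GroupLieAlgebra I G)} {x y : GroupLieAlgebra I G}

theorem lieAd_lieGroupExp_zero_smul (v : GroupLieAlgebra I G) :
    lieAd I G (lieGroupExp I ((0 : ℝ) • v)) = 1 := by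
  rw [zero_smul, lieGroupExp_zero, map_one]

theorem lieAd_lieGroupExp_add_smul (v : GroupLieAlgebra I G) (s t : ℝ) :
    lieAd I G (lieGroupExp I ((s + t) • v)) =
      lieAd I G (lieGroupExp I (s • v)) * lieAd I G (lieGroupExp I (t • v)) := by
  rw [lieGroupExp_add_smul, map_mul]

theorem continuous_trace_lieAd_lieGroupExp_smul [FiniteDimensional ℝ E]
    (v : GroupLieAlgebra I G) :
    Continuous fun t : ℝ => LinearMap.trace ℝ _ (lieAd I G (lieGroupExp I (t • v))) := by
  have : T2Space (GroupLieAlgebra I G) := inferInstanceAs (T2Space E)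
  have : FiniteDimensional ℝ (GroupLieAlgebra I G) := inferInstanceAs (FiniteDimensional ℝ E)
  exact continuous_trace_comp fun w =>
    (continuous_lieAd_apply w).comp (continuous_lieGroupExp_smul v)

theorem exists_lieAd_eq_halfTurn [PreconnectedSpace G] (hdim : finrank ℝ E = 3)
    (hcenter : LieAlgebra.center ℝ (GroupLieAlgebra I G) = ⊥) (hB : IsInnerProduct B)
    (hBG : ∀ g v w, B (lieAd I G g v) (lieAd I G g w) = B v w) (hy : y ≠ 0) :
    ∃ g, lieAd I G g = halfTurn B y := by
  have : FiniteDimensional ℝ E := .of_finrank_eq_succ hdim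
  rcases hB.forall_eq_one_or_exists_trace_eq_neg_one hdim (lieAd_lieGroupExp_zero_smul y)
      (lieAd_lieGroupExp_add_smul y) (fun t => hBG _)
      (continuous_trace_lieAd_lieGroupExp_smul y) with htriv | ⟨t, ht⟩
  · have hmem := mem_center_of_lieAd_lieGroupExp_eq_one htriv
    rw [hcenter, LieSubmodule.mem_bot] at hmem
    exact absurd hmem hy
  · exact ⟨_, hB.eq_halfTurn hdim (hBG _) ht hy (lieAd_lieGroupExp_smul_self t y)⟩

theorem two_mul_mem_expPeriods [PreconnectedSpace G] {T : ℝ}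
    (hT : lieAd I G (lieGroupExp I (T • x)) = 1) {g : G} (hg : lieAd I G g x = -x) :
    2 * T ∈ expPeriods x := by
  have hinv : lieGroupExp I (T • x) = lieGroupExp I (-T • x) := by
    rw [neg_smul, ← smul_neg, ← hg, ← map_smul, ← conj_lieGroupExp,
      Subgroup.mem_center_iff.1 (mem_center_of_lieAd_eq_one hT), mul_inv_cancel_right]
  rw [mem_expPeriods, two_mul, lieGroupExp_add_smul]
  nth_rewrite 1 [hinv]
  rw [← lieGroupExp_add_smul, neg_add_cancel, zero_smul, lieGroupExp_zero]

theorem exists_pos_mem_expPeriods [PreconnectedSpace G] (hdim : finrank ℝ E = 3)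
    (hB : IsInnerProduct B) (hBG : ∀ g v w, B (lieAd I G g v) (lieAd I G g w) = B v w)
    (hturn : ∀ y, y ≠ 0 → ∃ g, lieAd I G g = halfTurn B y) (x : GroupLieAlgebra I G) :
    ∃ T > 0, T ∈ expPeriods x := by
  have : FiniteDimensional ℝ E := .of_finrank_eq_succ hdim
  obtain ⟨T, hT, hTx⟩ := hB.exists_period hdim (lieAd_lieGroupExp_zero_smul x)
    (lieAd_lieGroupExp_add_smul x) (fun t => hBG _) (continuous_trace_lieAd_lieGroupExp_smul x)
  obtain ⟨y, hy, hyx⟩ := hB.exists_ne_zero_apply_eq_zero (hdim.symm ▸ by norm_num) x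
  obtain ⟨g, hg⟩ := hturn y hy
  exact ⟨2 * T, by positivity,
    two_mul_mem_expPeriods hTx (hg ▸ halfTurn_apply_of_eq_zero hyx)⟩

end AdjointRotations

section Automorphisms

variable {E : Type*} [NormedAddCommGroup E] [NormedSpace ℝ E]
  {H : Type*} [TopologicalSpace H] {I : ModelWithCorners ℝ E H} [I.Boundaryless]
  {G : Type*} [TopologicalSpace G] [T2Space G] [ChartedSpace H G] [Group G] [LieGroup I ∞ G]

theorem IsLinearVectorField.exists_monoidHom {V : (g : G) → TangentSpace I g} {φ : ℝ → G → G}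
    (hV : IsLinearVectorField I V) (hφ : IsFlowOf I V φ) :
    ∃ f : ℝ → G →* G, (∀ t, MDifferentiable I I (f t)) ∧ ∀ t g, f t g = φ t g := by
  obtain ⟨φ', hφ', haut⟩ := hV.exists_flow
  obtain rfl := hφ.unique (hV.contMDiff.of_le (by norm_cast)) hφ'
  choose f hf _ hfφ using haut
  exact ⟨fun t => (f t).toMonoidHom, fun t => (hf t).mdifferentiable (by simp), hfφ⟩

variable [CompleteSpace E] {B : LinearMap.BilinForm ℝ (GroupLieAlgebra I G)} {f : G →* G}

theorem apply_lieDifferential_self (hdim : 1 < finrank ℝ E) (hB : IsInnerProduct B)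
    (hturn : ∀ y, y ≠ 0 → ∃ g, lieAd I G g = halfTurn B y) (hf : MDifferentiable I I f)
    (hinj : Function.Injective f) {x : GroupLieAlgebra I G}
    (hperiod : ∃ T > 0, T ∈ expPeriods x) :
    B (lieDifferential I I f x) (lieDifferential I I f x) = B x x := by
  obtain ⟨T, hT, hTx⟩ := hperiod
  rcases eq_or_ne x 0 with rfl | hx
  · rw [map_zero]
  set y := lieDifferential I I f x
  have hperiods : expPeriods y = expPeriods x := expPeriods_lieDifferential hf hinj x
  have hy0 : y ≠ 0 := fun h => hx (expPeriods_eq_top_iff.1 (hperiods ▸ expPeriods_eq_top_iff.2 h))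
  have hxx := hB.pos x hx
  have hyy := hB.pos y hy0
  have hnorm : B (√(B y y / B x x) • x) (√(B y y / B x x) • x) = B y y := by
    rw [map_smul, map_smul, LinearMap.smul_apply, smul_smul, Real.mul_self_sqrt (by positivity),
      smul_eq_mul, div_mul_cancel₀ _ hxx.ne']
  obtain ⟨z, hz, hzx⟩ := hB.exists_halfTurn_apply_eq hdim hnorm
  obtain ⟨g, hg⟩ := hturn z hz
  have hscale : √(B y y / B x x) = 1 :=
    eq_one_of_expPeriods_smul_eq hx hT hTx (by positivity)
      (by rw [← expPeriods_lieAd g, hg, hzx, hperiods])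
  rwa [Real.sqrt_eq_one, div_eq_one_iff_eq hxx.ne'] at hscale

theorem lieDifferential_lieAd (hf : MDifferentiable I I f) (g : G) (v : GroupLieAlgebra I G) :
    lieDifferential I I f (lieAd I G g v) = lieAd I G (f g) (lieDifferential I I f v) :=
  eq_of_forall_lieGroupExp_smul_eq fun t => by
    rw [← map_smul, ← map_smul, ← map_smul, ← map_smul, ← map_lieGroupExp hf, ← conj_lieGroupExp,
      ← conj_lieGroupExp, ← map_lieGroupExp hf, map_mul, map_mul, map_inv]

theorem lieAd_map_eq_halfTurn (hf : MDifferentiable I I f)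
    (hsurj : Function.Surjective (lieDifferential I I f))
    (hisom : ∀ v w, B (lieDifferential I I f v) (lieDifferential I I f w) = B v w) {g : G}
    {y : GroupLieAlgebra I G} (hg : lieAd I G g = halfTurn B y) :
    lieAd I G (f g) = halfTurn B (lieDifferential I I f y) := by
  ext w
  obtain ⟨v, rfl⟩ := hsurj w
  rw [← lieDifferential_lieAd hf, hg]
  exact (halfTurn_map (L := (lieDifferential I I f : _ →L[ℝ] _)) hisom y v).symm

theorem apply_lieDifferential_apply (hdim : 1 < finrank ℝ E) (hB : IsInnerProduct B)
    (hturn : ∀ y, y ≠ 0 → ∃ g, lieAd I G g = halfTurn B y)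
    (hperiod : ∀ x : GroupLieAlgebra I G, ∃ T > 0, T ∈ expPeriods x) (hf : MDifferentiable I I f)
    (hinj : Function.Injective f) (v w : GroupLieAlgebra I G) :
    B (lieDifferential I I f v) (lieDifferential I I f w) = B v w :=
  hB.apply_apply_of_self (L := (lieDifferential I I f : _ →L[ℝ] _))
    (fun x => apply_lieDifferential_self hdim hB hturn hf hinj (hperiod x)) v w

theorem continuous_halfTurn_lieDifferential [FiniteDimensional ℝ E] {X : Type*}
    [TopologicalSpace X] {f : X → G →* G} (hf : ∀ t, MDifferentiable I I (f t))
    (hcont : ∀ g, Continuous fun t => f t g)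
    (hsurj : ∀ t, Function.Surjective (lieDifferential I I (f t)))
    (hisom : ∀ t v w, B (lieDifferential I I (f t) v) (lieDifferential I I (f t) w) = B v w)
    {g : G} {y : GroupLieAlgebra I G} (hg : lieAd I G g = halfTurn B y)
    (v w : GroupLieAlgebra I G) :
    Continuous fun t => B w (halfTurn B (lieDifferential I I (f t) y) v) := by
  have : FiniteDimensional ℝ (GroupLieAlgebra I G) := inferInstanceAs (FiniteDimensional ℝ E)
  have : T2Space (GroupLieAlgebra I G) := inferInstanceAs (T2Space E)
  simp only [← lieAd_map_eq_halfTurn (hf _) (hsurj _) (hisom _) hg]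
  exact (B w).continuous_of_finiteDimensional.comp ((continuous_lieAd_apply v).comp (hcont g))

theorem exists_period_of_automorphisms [PreconnectedSpace G] (hdim : finrank ℝ E = 3)
    (hB : IsInnerProduct B) (hturn : ∀ y, y ≠ 0 → ∃ g, lieAd I G g = halfTurn B y)
    (hperiod : ∀ x : GroupLieAlgebra I G, ∃ T > 0, T ∈ expPeriods x) {f : ℝ → G →* G}
    (hf : ∀ t, MDifferentiable I I (f t)) (hcont : ∀ g, Continuous fun t => f t g)
    (hzero : f 0 = MonoidHom.id G) (hadd : ∀ s t, f (s + t) = (f s).comp (f t)) :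
    ∃ T > 0, f T = MonoidHom.id G := by
  have : FiniteDimensional ℝ E := .of_finrank_eq_succ hdim
  let D (t : ℝ) : Module.End ℝ (GroupLieAlgebra I G) :=
    (lieDifferential I I (f t) : _ →L[ℝ] _)
  have hDzero : D 0 = 1 := by
    simp only [D, hzero]
    exact congrArg ContinuousLinearMap.toLinearMap lieDifferential_id
  have hDadd (s t : ℝ) : D (s + t) = D s * D t := by
    simp only [D, hadd]
    exact congrArg ContinuousLinearMap.toLinearMap
      (lieDifferential_comp (hf s) (hf t) (map_one _))
  have hsurj (t : ℝ) : Function.Surjective (D t) := fun v =>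
    ⟨D (-t) v, by rw [← End.mul_apply, ← hDadd, add_neg_cancel, hDzero, End.one_apply]⟩
  have hinj (t : ℝ) : Function.Injective (f t) :=
    Function.LeftInverse.injective (g := f (-t)) fun g => by
      rw [← MonoidHom.comp_apply, ← hadd, neg_add_cancel, hzero, MonoidHom.id_apply]
  have hisom (t : ℝ) : ∀ v w, B (D t v) (D t w) = B v w :=
    apply_lieDifferential_apply (hdim.symm ▸ by norm_num) hB hturn hperiod (hf t) (hinj t)
  have hDturn (y : GroupLieAlgebra I G) (hy : y ≠ 0) (v w : GroupLieAlgebra I G) :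
      Continuous fun t => B w (halfTurn B (D t y) v) := by
    obtain ⟨g, hg⟩ := hturn y hy
    exact continuous_halfTurn_lieDifferential hf hcont hsurj hisom hg v w
  obtain ⟨T, hT, hDT⟩ :=
    hB.exists_period_of_continuous_halfTurn hdim hDzero hDadd hisom hDturn
  refine ⟨T, hT, eq_of_lieDifferential_eq (hf T) mdifferentiable_id ?_⟩
  exact ContinuousLinearMap.coe_injective
    (hDT.trans (congrArg ContinuousLinearMap.toLinearMap lieDifferential_id).symm)

end Automorphisms

theorem mainTheorem6
    {E : Type*} [NormedAddCommGroup E] [NormedSpace ℝ E] [CompleteSpace E]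
    {H : Type*} [TopologicalSpace H] (I : ModelWithCorners ℝ E H) [I.Boundaryless]
    (G : Type*) [TopologicalSpace G] [T2Space G] [CompactSpace G] [ConnectedSpace G]
    [ChartedSpace H G] [Group G] [LieGroup I ∞ G]
    (hdim : Module.finrank ℝ E = 3)
    (hss : LieAlgebra.IsSemisimple ℝ (GroupLieAlgebra I G)) :
    (∀ X : GroupLieAlgebra I G,
      IsFlowOf I (rightInvariantVectorField I X) (fun t g => lieGroupExp I (t • X) * g) ∧
      (X ≠ 0 → ∀ g : G, IsPeriodicOrbit (fun t : ℝ => lieGroupExp I (t • X) * g))) ∧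
    (∀ (V : (g : G) → TangentSpace I g) (φ : ℝ → G → G),
      IsLinearVectorField I V → IsFlowOf I V φ →
      ∀ g : G, (∀ t : ℝ, φ t g = g) ∨ IsPeriodicOrbit (fun t : ℝ => φ t g)) := by
  have : FiniteDimensional ℝ E := .of_finrank_eq_succ hdim
  obtain ⟨B, hB, hBG⟩ := exists_isInnerProduct_lieAd (I := I) (G := G)
  have hturn (y) (hy : y ≠ 0) : ∃ g, lieAd I G g = halfTurn B y :=
    exists_lieAd_eq_halfTurn hdim (LieAlgebra.center_eq_bot ℝ _) hB hBG hy
  have hperiod := exists_pos_mem_expPeriods hdim hB hBG hturn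
  refine ⟨fun X => ⟨isFlowOf_lieGroupExp X, fun hX g => ?_⟩, fun V φ hV hφ g => ?_⟩
  · obtain ⟨T, hT, hTX⟩ := hperiod X
    refine ((isFlowOf_lieGroupExp X).fixed_or_isPeriodicOrbit
      (contMDiff_rightInvariantVectorField X) hT (mul_eq_right.2 hTX)).resolve_left fun hfix => ?_
    exact hX (expPeriods_eq_top_iff.1 ((AddSubgroup.eq_top_iff' _).2 fun t =>
      mul_eq_right.1 (hfix t)))
  · have hV1 := hV.contMDiff.of_le (m := 1) (by norm_cast)
    obtain ⟨f, hf, hfφ⟩ := hV.exists_monoidHom hφ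
    obtain ⟨T, hT, hfT⟩ := exists_period_of_automorphisms hdim hB hturn hperiod hf
      (fun g => by simpa only [hfφ] using (hφ.isMIntegralCurve g).continuous)
      (MonoidHom.ext fun g => (hfφ 0 g).trans (hφ.map_zero g))
      (fun s t => MonoidHom.ext fun g => by
        rw [MonoidHom.comp_apply, hfφ, hfφ, hfφ, hφ.add_apply hV1])
    exact hφ.fixed_or_isPeriodicOrbit hV1 hT ((hfφ T g).symm.trans (DFunLike.congr_fun hfT g))
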